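/- Let $\mathsf{HA}$ be intuitionistic first-order arithmetic with equality, in the language with function symbols for all primitive recursive functions (introduced by their primitive recursive definitions), with logical constants $\forall,\exists,\to,\land,\lor,\perp$ and $\neg\varphi:\equiv\varphi\to\perp$. Let $\Sigma_1$ be the class of formulas $\exists x_1\cdots\exists x_l\,\psi$ with $l\ge 0$ and $\psi$ quantifier-free, and let $\Sigma_1\text{-}\mathrm{DNE}$ be the scheme $\forall x\,(\neg\neg\varphi(x)\to\varphi(x))$, where $\varphi(x)\in\Sigma_1$ has no free variables other than $x$. To a formula $\varphi$ assign a finite set $\mathrm{Alt}(\varphi)$ of sequences of the signs $+,-$ as follows: $\mathrm{Alt}(\varphi)=\{\langle\,\rangle\}$ if $\varphi$ is quantifier-free; otherwise $\mathrm{Alt}(\neg\varphi_1)=\{s^\perp: s\in \mathrm{Alt}(\varphi_1)\}$, where $s^\perp$ is $s$ with the signs switched; $\mathrm{Alt}(\varphi_1\land\varphi_2)=\mathrm{Alt}(\varphi_1\lor\varphi_2)=\mathrm{Alt}(\varphi_1)\cup \mathrm{Alt}(\varphi_2)$; $\mathrm{Alt}(\varphi_1\to\varphi_2)=\{s^\perp: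 s\in \mathrm{Alt}(\varphi_1)\}\cup \mathrm{Alt}(\varphi_2)$; and $\mathrm{Alt}(\forall x\varphi_1)$ (resp. $\mathrm{Alt}(\exists x\varphi_1)$) is obtained from $\mathrm{Alt}(\varphi_1)$ by putting $-$ (resp. $+$) in front of every sequence that does not already begin with that sign. Let $\mathrm{E}_1$ be the class of formulas $\varphi$ such that the maximal length of the sequences in $\mathrm{Alt}(\varphi)$ is $1$ and every sequence of length $1$ in $\mathrm{Alt}(\varphi)$ is $\langle + \rangle$. Let $\mathrm{T}$ and $\mathrm{U}$ be the standard primitive recursive predicate and function of Kleene's normal form theorem: $\mathrm{T}(e,x,u)$ says that $u$ is the (unique) halting computation of program $e$ on input $x$, and $\mathrm{U}(u)$ is its output. Consider the sentence $$\varphi_0:\equiv \neg \forall x \bigl( \neg \exists u\, ( \mathrm{T}(x,x,u) \land \mathrm{U}(u)=0 ) \lor \neg \exists u\, ( \mathrm{T}(x,x,u) \land \mathrm{U}(u)\neq 0 ) \bigr).$$ Then: 1. $\varphi_0\in\mathrm{E}_1$. 2. There is no sentence $\varphi_0'\in\Sigma_1$ such that $\mathsf{HA}+\Sigma_1\text{-}\mathrm{DNE}\vdash\varphi_0\leftrightarrow\varphi_0'$.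 3. Consequently, the following assertion is false: for every $\varphi\in\mathrm{E}_1$ there is $\varphi'\in\Sigma_1$ (possibly with further free variables) such that $\mathsf{HA}+\Sigma_1\text{-}\mathrm{DNE}\vdash\varphi\leftrightarrow\varphi'$. -/

import Mathlib

namespace HA

/-! ## Primitive recursive function symbols -/

/-- The function symbols: definitions of primitive recursive functions, by arity. -/
inductive PRSym : ℕ → Type
  | zero : PRSym 0
  | succ : PRSym 1
  | proj {n : ℕ} (i : Fin n) : PRSym n
  | comp {m n : ℕ} (f : PRSym m) (g : Fin m → PRSym n) : PRSym n
  | prec {n : ℕ} (f : PRSym n) (g : PRSym (n + 2)) : PRSym (n + 1)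

namespace PRSym

/-- The primitive recursive function denoted by a symbol. In `prec f g` the first argument is the
recursion variable. -/
def eval : {n : ℕ} → PRSym n → (Fin n → ℕ) → ℕ
  | _, zero, _ => 0
  | _, succ, v => v 0 + 1
  | _, proj i, v => v i
  | _, comp f g, v => f.eval fun i => (g i).eval v
  | _, prec f g, v =>
      Nat.rec (f.eval (Fin.tail v))
        (fun y ih => g.eval (Fin.cons y (Fin.cons ih (Fin.tail v)))) (v 0)

/-! ### A library of primitive recursive definitions

Each operation below takes symbols `a, b, …` of arity `n` (the arguments, as functions of `n`
variables) and returns a symbol of arity `n`. -/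

variable {n : ℕ}

/-- The constant `k`. -/
def num : ℕ → PRSym n
  | 0 => comp zero Fin.elim0
  | k + 1 => comp succ ![num k]

def suc (a : PRSym n) : PRSym n := comp succ ![a]

/-- Predecessor, with `pred 0 = 0`. -/
def pred (a : PRSym n) : PRSym n := comp (prec zero (proj 0)) ![a]

def add (a b : PRSym n) : PRSym n := comp (prec (proj 0) (suc (proj 1))) ![a, b]

def mul (a b : PRSym n) : PRSym n :=
  comp (prec (num 0) (add (proj 1) (proj 2))) ![a, b]

/-- Truncated subtraction `a - b`. -/
def sub (a b : PRSym n) : PRSym n := comp (prec (proj 0) (pred (proj 1))) ![b, a]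

/-- `if a = 0 then b else c`. -/
def ifz (a b c : PRSym n) : PRSym n := comp (prec (proj 0) (proj 3)) ![a, b, c]

/-- Integer square root. -/
def sqrt (a : PRSym n) : PRSym n :=
  comp (prec zero
    (ifz (sub (mul (suc (proj 1)) (suc (proj 1))) (suc (proj 0))) (suc (proj 1)) (proj 1))) ![a]

/-- The pairing function `Nat.pair`. -/
def pair (a b : PRSym n) : PRSym n :=
  ifz (sub (suc a) b) (add (mul b b) a) (add (add (mul a a) a) b)

/-- `a - (sqrt a)²`. -/
def sqrtRem (a : PRSym n) : PRSym n := sub a (mul (sqrt a) (sqrt a))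

/-- First projection of `Nat.unpair`. -/
def fst (a : PRSym n) : PRSym n :=
  ifz (sub (suc (sqrtRem a)) (sqrt a)) (sqrtRem a) (sqrt a)

/-- Second projection of `Nat.unpair`. -/
def snd (a : PRSym n) : PRSym n :=
  ifz (sub (suc (sqrtRem a)) (sqrt a)) (sqrt a) (sub (sqrtRem a) (sqrt a))

/-- `switch t [a₀, a₁, …, aₗ] d` is `a_t` if `t ≤ l` and `d` otherwise. -/
def switch (t : PRSym n) : List (PRSym n) → PRSym n → PRSym n
  | [], d => d
  | a :: as, d => ifz t a (switch (pred t) as d)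

section evalLemmas
variable (v : Fin n → ℕ) (a b c : PRSym n)

@[simp] theorem eval_proj (i : Fin n) : (proj i).eval v = v i := rfl

@[simp] theorem eval_num (k : ℕ) : (num k : PRSym n).eval v = k := by
  induction k with
  | zero => rfl
  | succ k ih => simp [num, eval, ih]

@[simp] theorem eval_suc : (suc a).eval v = a.eval v + 1 := rfl

@[simp] theorem eval_pred : (pred a).eval v = a.eval v - 1 := by
  simp only [pred, eval]
  show Nat.rec (motive := fun _ => ℕ) 0 (fun y ih => y) (a.eval v) = _
  cases a.eval v <;> rfl

@[simp] theorem eval_add : (add a b).eval v = a.eval v + b.eval v := by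
  simp only [add, eval]
  show Nat.rec (motive := fun _ => ℕ) (b.eval v) (fun y ih => ih + 1) (a.eval v) = _
  induction a.eval v with
  | zero => simp
  | succ k ih => simp only [ih]; omega

@[simp] theorem eval_mul : (mul a b).eval v = a.eval v * b.eval v := by
  simp only [mul, eval, eval_add, eval_num]
  show Nat.rec (motive := fun _ => ℕ) 0 (fun y ih => ih + b.eval v) (a.eval v) = _
  induction a.eval v with
  | zero => simp
  | succ k ih => simp only [ih]; ring

@[simp] theorem eval_sub : (sub a b).eval v = a.eval v - b.eval v := by
  simp only [sub, eval, eval_pred]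
  show Nat.rec (motive := fun _ => ℕ) (a.eval v) (fun y ih => ih - 1) (b.eval v) = _
  induction b.eval v with
  | zero => simp
  | succ k ih => simp only [ih]; omega

@[simp] theorem eval_ifz :
    (ifz a b c).eval v = if a.eval v = 0 then b.eval v else c.eval v := by
  simp only [ifz, eval]
  show Nat.rec (motive := fun _ => ℕ) (b.eval v) (fun y ih => c.eval v) (a.eval v) = _
  cases a.eval v <;> simp

@[simp] theorem eval_sqrt : (sqrt a).eval v = Nat.sqrt (a.eval v) := by
  simp only [sqrt, eval, eval_ifz, eval_sub, eval_mul, eval_suc]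
  show Nat.rec (motive := fun _ => ℕ) 0 (fun y ih => if (ih + 1) * (ih + 1) - (y + 1) = 0 then ih + 1 else ih)
    (a.eval v) = _
  induction a.eval v with
  | zero => simp
  | succ k ih =>
    simp only [ih]
    have h1 := Nat.sqrt_le k
    have h3 := Nat.lt_succ_sqrt k
    simp only [Nat.succ_eq_add_one] at h3
    split_ifs with h
    · exact (Nat.eq_sqrt.2 ⟨by omega, by nlinarith⟩)
    · exact (Nat.eq_sqrt.2 ⟨by omega, by omega⟩)

@[simp] theorem eval_pair : (pair a b).eval v = Nat.pair (a.eval v) (b.eval v) := by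
  simp only [pair, eval_ifz, eval_sub, eval_mul, eval_suc, eval_add, Nat.pair]
  split_ifs <;> omega

@[simp] theorem eval_fst : (fst a).eval v = (Nat.unpair (a.eval v)).1 := by
  simp only [fst, sqrtRem, eval_ifz, eval_sub, eval_mul, eval_suc, eval_sqrt, Nat.unpair]
  split_ifs <;> first | rfl | omega

@[simp] theorem eval_snd : (snd a).eval v = (Nat.unpair (a.eval v)).2 := by
  simp only [snd, sqrtRem, eval_ifz, eval_sub, eval_mul, eval_suc, eval_sqrt, Nat.unpair]
  split_ifs <;> first | rfl | omega

end evalLemmas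

end PRSym

/-! ## Kleene's predicate `T` and function `U`

Programs are those of `Nat.Partrec.Code`, numbered by `progNum`. They are run on an abstract machine
with a stack of pending operations. A machine state is a triple `(m, v, k)`: if `m = p + 1`, program
number `p` is to be run on input `v`; if `m = 0`, the value `v` has been computed. In both cases the
result is passed to the stack `k`, which is `0` when empty. The state `(0, v, 0)` is the final
state with output `v`. -/

section Kleene
open PRSym

/-- Numbering of programs. -/
def progNum : Nat.Partrec.Code → ℕ
  | .zero => Nat.pair 0 0
  | .succ => Nat.pair 1 0
  | .left => Nat.pair 2 0
  | .right => Nat.pair 3 0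
  | .pair f g => Nat.pair 4 (Nat.pair (progNum f) (progNum g))
  | .comp f g => Nat.pair 5 (Nat.pair (progNum f) (progNum g))
  | .prec f g => Nat.pair 6 (Nat.pair (progNum f) (progNum g))
  | .rfind' f => Nat.pair 7 (Nat.pair (progNum f) 0)

/-- The state `(m, v, k)`. -/
def state {n : ℕ} (m v k : PRSym n) : PRSym n := pair m (pair v k)

/-- Push the pending operation `(t, a, b)` onto the stack `k`. -/
def push {n : ℕ} (t : ℕ) (a b k : PRSym n) : PRSym n :=
  suc (pair (pair (num t) (pair a b)) k)

/-- One step of the machine. -/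
def stepSym : PRSym 1 :=
  let s : PRSym 1 := proj 0
  let m := fst s
  let v := fst (snd s)
  let k := snd (snd s)
  -- the program to be run, `p = (tag, f, g)`
  let p := pred m
  let tag := fst p
  let f := fst (snd p)
  let g := snd (snd p)
  -- the top of the stack, `(op, a, b)`, and the rest `k'` of the stack
  let top := fst (pred k)
  let k' := snd (pred k)
  let op := fst top
  let a := fst (snd top)
  let b := snd (snd top)
  ifz m
    (ifz k
      -- a final state is left for ever
      (state (num 0) (num 0) (push 5 (num 0) (num 0) (num 0)))
      (switch op
        [ -- operation 0: keep `v`, run `a` on `b`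
          state (suc a) b (push 1 v (num 0) k'),
          -- operation 1: return the pair `(a, v)`
          state (num 0) (pair a v) k',
          -- operation 2: run `a` on `v`
          state (suc a) v k',
          -- operation 3: recursion step, run `a` on `(b₁, (b₂, v))`
          state (suc a) (pair (fst b) (pair (snd b) v)) k',
          -- operation 4: search, `a` is the searching program and `b` its input
          ifz v (state (num 0) (snd b) k')
            (state (suc a) (pair (fst b) (suc (snd b))) k') ]
        s))
    (switch tag
      [ state (num 0) (num 0) k,
        state (num 0) (suc v) k,
        state (num 0) (fst v) k,
        state (num 0) (snd v) k,
        state (suc f) v (push 0 g v k),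
        state (suc g) v (push 2 f (num 0) k),
        ifz (snd v) (state (suc f) (fst v) k)
          (state m (pair (fst v) (pred (snd v))) (push 3 g (pair (fst v) (pred (snd v))) k)) ]
      (state (suc f) v (push 4 p v k)))

/-- `runSym (t, s)` is the state reached from the state `s` after `t` steps. -/
def runSym : PRSym 2 := prec (proj 0) (comp stepSym ![proj 1])

/-- The symbol of Kleene's function `U`: the output recorded in the computation `u`. -/
def symU : PRSym 1 := snd (proj 0)

/-- The symbol of (the characteristic function of) Kleene's predicate `T`: `symT (e, x, u) = 0` iff
`u` is the computation `(t, y)` of program `e` on input `x`, that is, starting with an empty stack,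
the machine reaches the final state with output `y` after `t` steps. -/
def symT : PRSym 3 :=
  let run : PRSym 3 :=
    comp runSym ![fst (proj 2), state (suc (proj 0)) (proj 1) (num 0)]
  let final : PRSym 3 := state (num 0) (comp symU ![proj 2]) (num 0)
  add (sub run final) (sub final run)

end Kleene

/-! ### Adequacy of `symT` and `symU`: Kleene's normal form theorem -/

section Adequacy
open PRSym
open Nat.Partrec (Code)

/-- The number of the state `(m, v, k)`. -/
def st (m v k : ℕ) : ℕ := Nat.pair m (Nat.pair v k)
/-- The number of the stack obtained by pushing `(t, a, b)` onto `k`. -/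
def pu (t a b k : ℕ) : ℕ := Nat.pair (Nat.pair t (Nat.pair a b)) k + 1
/-- One step of the machine, on numbers. -/
def stepN (c : ℕ) : ℕ := stepSym.eval ![c]
/-- The state after `t` steps from `s`. -/
def runN (t s : ℕ) : ℕ := runSym.eval ![t, s]

@[simp] theorem eval_state {n} (v : Fin n → ℕ) (a b c : PRSym n) :
   (state a b c).eval v = st (a.eval v) (b.eval v) (c.eval v) := by simp [state, st]
@[simp] theorem eval_push {n} (v : Fin n → ℕ) (t) (a b c : PRSym n) :
   (push t a b c).eval v = pu t (a.eval v) (b.eval v) (c.eval v) := by simp [push, pu]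

theorem runN_zero (s) : runN 0 s = s := rfl
theorem runN_succ (t s) : runN (t+1) s = stepN (runN t s) := by
  have h : ∀ (g : PRSym 1), (prec (proj 0) (comp g ![proj 1])).eval ![t+1, s] =
      g.eval ![(prec (proj 0) (comp g ![proj 1])).eval ![t, s]] := by
    intro g
    show g.eval _ = g.eval _
    congr 1
    funext i; fin_cases i; rfl
  exact h stepSym
theorem runN_succ' (t s) : runN (t+1) s = runN t (stepN s) := by
  induction t with
  | zero => rw [runN_succ, runN_zero, runN_zero]
  | succ t ih => rw [runN_succ, ih, runN_succ]
theorem runN_add (t u s) : runN (t+u) s = runN u (runN t s) := by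
  induction u with
  | zero => rfl
  | succ u ih => rw [← add_assoc, runN_succ, ih, runN_succ]

theorem st1 (m v k) : (Nat.unpair (st m v k)).1 = m := by simp [st]
theorem st2 (m v k) : (Nat.unpair (Nat.unpair (st m v k)).2).1 = v := by simp [st]
theorem st3 (m v k) : (Nat.unpair (Nat.unpair (st m v k)).2).2 = k := by simp [st]
theorem pu1 (t a b k) : (Nat.unpair (Nat.unpair (pu t a b k - 1)).1).1 = t := by simp [pu]
theorem pu2 (t a b k) : (Nat.unpair (Nat.unpair (Nat.unpair (pu t a b k - 1)).1).2).1 = a := by simp [pu]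
theorem pu3 (t a b k) : (Nat.unpair (Nat.unpair (Nat.unpair (pu t a b k - 1)).1).2).2 = b := by simp [pu]
theorem pu4 (t a b k) : (Nat.unpair (pu t a b k - 1)).2 = k := by simp [pu]
theorem pu0 (t a b k) : pu t a b k ≠ 0 := by simp [pu]
theorem step_final (v) : stepN (st 0 v 0) = st 0 0 (pu 5 0 0 0) := by
  simp [stepN, stepSym, switch, st1, st3]
theorem step_op5 (v a b k) : stepN (st 0 v (pu 5 a b k)) = st 0 v (pu 5 a b k) := by
  simp [stepN, stepSym, switch, st1, st3, pu0, pu1]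
theorem step_dead : stepN (st 0 0 (pu 5 0 0 0)) = st 0 0 (pu 5 0 0 0) := step_op5 _ _ _ _
theorem step_op0 (v a b k) : stepN (st 0 v (pu 0 a b k)) = st (a+1) b (pu 1 v 0 k) := by
  simp [stepN, stepSym, switch, st1, st2, st3, pu0, pu1, pu2, pu3, pu4]
theorem step_op1 (v a b k) : stepN (st 0 v (pu 1 a b k)) = st 0 (Nat.pair a v) k := by
  simp [stepN, stepSym, switch, st1, st2, st3, pu0, pu1, pu2, pu4]
theorem step_op2 (v a b k) : stepN (st 0 v (pu 2 a b k)) = st (a+1) v k := by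
  simp [stepN, stepSym, switch, st1, st2, st3, pu0, pu1, pu2, pu4]
theorem step_op3 (v a b c k) : stepN (st 0 v (pu 3 a (Nat.pair b c) k)) =
    st (a+1) (Nat.pair b (Nat.pair c v)) k := by
  simp [stepN, stepSym, switch, st1, st2, st3, pu0, pu1, pu2, pu3, pu4]
theorem step_op4_zero (a b c k) : stepN (st 0 0 (pu 4 a (Nat.pair b c) k)) = st 0 c k := by
  simp [stepN, stepSym, switch, st1, st2, st3, pu0, pu1, pu3, pu4]
theorem step_op4_succ (v a b c k) : stepN (st 0 (v+1) (pu 4 a (Nat.pair b c) k)) =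
    st (a+1) (Nat.pair b (c+1)) k := by
  simp [stepN, stepSym, switch, st1, st2, st3, pu0, pu1, pu2, pu3, pu4]

theorem step_zero (v k) : stepN (st (progNum .zero + 1) v k) = st 0 0 k := by
  simp [stepN, stepSym, st, progNum, switch]
theorem step_succ (v k) : stepN (st (progNum .succ + 1) v k) = st 0 (v+1) k := by
  simp [stepN, stepSym, st, progNum, switch]
theorem step_left (v k) : stepN (st (progNum .left + 1) v k) = st 0 v.unpair.1 k := by
  simp [stepN, stepSym, st, progNum, switch]
theorem step_right (v k) : stepN (st (progNum .right + 1) v k) = st 0 v.unpair.2 k := by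
  simp [stepN, stepSym, st, progNum, switch]
theorem step_pair (f g v k) : stepN (st (progNum (.pair f g) + 1) v k) =
    st (progNum f + 1) v (pu 0 (progNum g) v k) := by
  simp [stepN, stepSym, st, progNum, switch]
theorem step_comp (f g v k) : stepN (st (progNum (.comp f g) + 1) v k) =
    st (progNum g + 1) v (pu 2 (progNum f) 0 k) := by
  simp [stepN, stepSym, st, progNum, switch]
theorem step_prec_zero (f g a k) : stepN (st (progNum (.prec f g) + 1) (Nat.pair a 0) k) =
    st (progNum f + 1) a k := by
  simp [stepN, stepSym, st, progNum, switch]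
theorem step_prec_succ (f g a m k) : stepN (st (progNum (.prec f g) + 1) (Nat.pair a (m+1)) k) =
    st (progNum (.prec f g) + 1) (Nat.pair a m) (pu 3 (progNum g) (Nat.pair a m) k) := by
  simp [stepN, stepSym, st, progNum, switch]
theorem step_rfind (f v k) : stepN (st (progNum (.rfind' f) + 1) v k) =
    st (progNum f + 1) v (pu 4 (progNum (.rfind' f)) v k) := by
  simp [stepN, stepSym, st, progNum, switch]

theorem mem_rfind0 (f : Code) (a m y : ℕ) : y ∈ (Code.rfind' f).eval (Nat.pair a m) ↔
    ∃ n, (0 ∈ f.eval (Nat.pair a (n + m)) ∧ ∀ j < n, ∃ v ∈ f.eval (Nat.pair a (j+m)), v ≠ 0) ∧ n + m = y := by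
  have h : (Code.rfind' f).eval (Nat.pair a m) = 
    (Nat.rfind fun n => (fun m => decide (m = 0)) <$> f.eval (Nat.pair a (n + m))).map (· + m) := by
    simp only [Code.eval, Nat.unpaired, Nat.unpair_pair]
  rw [h, Part.mem_map_iff]
  apply exists_congr
  intro n
  refine and_congr ((Nat.mem_rfind).trans ?_) Iff.rfl
  simp [Part.mem_map_iff]

theorem mem_rfind' (f : Code) (a m y : ℕ) : y ∈ (Code.rfind' f).eval (Nat.pair a m) ↔
    ∃ v ∈ f.eval (Nat.pair a m), (v = 0 ∧ y = m) ∨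
      (v ≠ 0 ∧ y ∈ (Code.rfind' f).eval (Nat.pair a (m+1))) := by
  simp only [mem_rfind0]
  constructor
  · rintro ⟨n, ⟨h0, hlt⟩, rfl⟩
    rcases n with _ | n
    · exact ⟨0, by simpa using h0, .inl ⟨rfl, by simp⟩⟩
    · obtain ⟨v, hv, hv0⟩ := hlt 0 (Nat.succ_pos n)
      refine ⟨v, by simpa using hv, .inr ⟨hv0, n, ⟨?_, ?_⟩, by omega⟩⟩
      · simpa [add_assoc, add_comm 1 m] using h0
      · intro j hj
        have := hlt (j+1) (Nat.succ_lt_succ hj)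
        simpa [add_assoc, add_comm 1 m] using this
  · rintro ⟨v, hv, ⟨rfl, rfl⟩ | ⟨hv0, n, ⟨h0, hlt⟩, rfl⟩⟩
    · exact ⟨0, ⟨by simpa using hv, by simp⟩, by simp⟩
    · refine ⟨n+1, ⟨?_, ?_⟩, by omega⟩
      · simpa [add_assoc, add_comm 1 m] using h0
      · intro j hj
        rcases j with _ | j
        · exact ⟨v, by simpa using hv, by simpa using hv0⟩
        · have := hlt j (Nat.lt_of_succ_lt_succ hj)
          simpa [add_assoc, add_comm 1 m] using this

/-- The machine gets from state `s` to state `s'`. -/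
def Reach (s s' : ℕ) : Prop := ∃ t, runN t s = s'
theorem Reach.head {s s' : ℕ} (h : Reach (stepN s) s') : Reach s s' := by
  obtain ⟨t, h⟩ := h; exact ⟨t+1, by rw [runN_succ', h]⟩
theorem Reach.trans {s s' s''} (h : Reach s s') (h' : Reach s' s'') : Reach s s'' := by
  obtain ⟨t, rfl⟩ := h; obtain ⟨u, rfl⟩ := h'; exact ⟨t+u, runN_add _ _ _⟩
theorem Reach.refl (s) : Reach s s := ⟨0, rfl⟩

theorem forward (c : Code) : ∀ x y k, y ∈ c.eval x → Reach (st (progNum c + 1) x k) (st 0 y k) := by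
  induction c with
  | zero => intro x y k h; apply Reach.head; rw [step_zero]; simp [Code.eval, pure, PFun.pure] at h; subst h; exact .refl _
  | succ => intro x y k h; apply Reach.head; rw [step_succ]; simp [Code.eval] at h; subst h; exact .refl _
  | left => intro x y k h; apply Reach.head; rw [step_left]; simp [Code.eval] at h; subst h; exact .refl _
  | right => intro x y k h; apply Reach.head; rw [step_right]; simp [Code.eval] at h; subst h; exact .refl _
  | pair f g hf hg =>
    intro x y k h
    simp [Code.eval, Seq.seq] at h
    obtain ⟨a, ha, b, hb, hy⟩ := h
    subst y
    apply Reach.head; rw [step_pair]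
    apply (hf _ _ _ ha).trans
    apply Reach.head; rw [step_op0]
    apply (hg _ _ _ hb).trans
    apply Reach.head; rw [step_op1]; exact .refl _
  | comp f g hf hg =>
    intro x y k h
    obtain ⟨a, ha, hb⟩ : ∃ a ∈ g.eval x, y ∈ f.eval a := Part.mem_bind_iff.1 h
    apply Reach.head; rw [step_comp]
    apply (hg _ _ _ ha).trans
    apply Reach.head; rw [step_op2]
    exact (hf _ _ _ hb)
  | prec f g hf hg =>
    intro x
    obtain ⟨a, m, rfl⟩ : ∃ a m, x = Nat.pair a m := ⟨_, _, (Nat.pair_unpair x).symm⟩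
    induction m with
    | zero =>
      intro y k h
      rw [Code.eval_prec_zero] at h
      apply Reach.head; rw [step_prec_zero]
      exact hf _ _ _ h
    | succ m ih =>
      intro y k h
      rw [Code.eval_prec_succ] at h
      simp at h
      obtain ⟨i, hi, h⟩ := h
      apply Reach.head; rw [step_prec_succ]
      apply (ih _ _ hi).trans
      apply Reach.head; rw [step_op3]
      exact hg _ _ _ h
  | rfind' f hf =>
    intro x y k h
    obtain ⟨a, m, rfl⟩ : ∃ a m, x = Nat.pair a m := ⟨_, _, (Nat.pair_unpair x).symm⟩
    have hy : m ≤ y := by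
      simp [Code.eval, Nat.unpaired] at h
      obtain ⟨n, _, rfl⟩ := h; omega
    obtain ⟨d, rfl⟩ := Nat.exists_eq_add_of_le hy
    clear hy
    induction d generalizing m with
    | zero =>
      obtain ⟨v, hv, ⟨rfl, hy⟩ | ⟨h0, hy⟩⟩ := (mem_rfind' _ _ _ _).1 h
      · apply Reach.head; rw [step_rfind]
        apply (hf _ _ _ hv).trans
        apply Reach.head; rw [step_op4_zero, ← hy]; exact .refl _
      · simp [Code.eval, Nat.unpaired] at hy
        obtain ⟨n, _, hn⟩ := hy; omega
    | succ d ih =>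
      obtain ⟨v, hv, ⟨rfl, hy⟩ | ⟨h0, hy⟩⟩ := (mem_rfind' _ _ _ _).1 h
      · omega
      · apply Reach.head; rw [step_rfind]
        apply (hf _ _ _ hv).trans
        obtain ⟨v, rfl⟩ := Nat.exists_eq_succ_of_ne_zero h0
        apply Reach.head; rw [step_op4_succ]
        have e : m + (d+1) = m+1+d := by omega
        rw [e] at hy ⊢
        exact ih _ hy

theorem backward (t : ℕ) : ∀ (c : Code) (x k v : ℕ), runN t (st (progNum c + 1) x k) = st 0 v 0 →
    ∃ y ∈ c.eval x, ∃ t' < t, runN t' (st 0 y k) = st 0 v 0 := by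
  induction t using Nat.strong_induction_on with
  | _ t ih =>
    intro c x k v h
    rcases t with _ | t
    · rw [runN_zero] at h; simp [st] at h
    have ih' : ∀ s, s ≤ t → ∀ (c : Code) (x k v : ℕ), runN s (st (progNum c + 1) x k) = st 0 v 0 →
      ∃ y ∈ c.eval x, ∃ t' < s, runN t' (st 0 y k) = st 0 v 0 := fun s hs => ih s (by omega)
    have pop : ∀ s, ∀ a op p q k, runN s (st 0 a (pu op p q k)) = st 0 v 0 → 
        ∃ s' , s = s' + 1 ∧ runN s' (stepN (st 0 a (pu op p q k))) = st 0 v 0 := by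
      intro s a op p q k hs
      rcases s with _ | s
      · rw [runN_zero] at hs; simp [st, pu] at hs
      · exact ⟨s, rfl, by rw [← runN_succ', hs]⟩
    rw [runN_succ'] at h
    cases c with
    | zero => rw [step_zero] at h; exact ⟨0, by simp [Code.eval, pure, PFun.pure], t, by omega, h⟩
    | succ => rw [step_succ] at h; exact ⟨x+1, by simp [Code.eval], t, by omega, h⟩
    | left => rw [step_left] at h; exact ⟨_, by simp [Code.eval], t, by omega, h⟩
    | right => rw [step_right] at h; exact ⟨_, by simp [Code.eval], t, by omega, h⟩
    | pair f g =>
      rw [step_pair] at h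
      obtain ⟨a, ha, t1, ht1, h⟩ := ih' t le_rfl _ _ _ _ h
      obtain ⟨t2, rfl, h'⟩ := pop _ _ _ _ _ _ h; replace h := h'; clear h'
      rw [step_op0] at h
      obtain ⟨b, hb, t3, ht3, h⟩ := ih' t2 (by omega) _ _ _ _ h
      obtain ⟨t4, rfl, h'⟩ := pop _ _ _ _ _ _ h; replace h := h'; clear h'
      rw [step_op1] at h
      exact ⟨_, by
        have : Nat.pair a b ∈ (Nat.pair <$> f.eval x <*> g.eval x) := by
          rw [seq_eq_bind_map]; simp only [Part.map_eq_map, Part.bind_eq_bind, Part.mem_bind_iff, Part.mem_map_iff]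
          exact ⟨_, ⟨a, ha, rfl⟩, b, hb, rfl⟩
        exact this, t4, by omega, h⟩
    | comp f g =>
      rw [step_comp] at h
      obtain ⟨a, ha, t1, ht1, h⟩ := ih' t le_rfl _ _ _ _ h
      obtain ⟨t2, rfl, h'⟩ := pop _ _ _ _ _ _ h; replace h := h'; clear h'
      rw [step_op2] at h
      obtain ⟨b, hb, t3, ht3, h⟩ := ih' t2 (by omega) _ _ _ _ h
      exact ⟨_, by
        have : b ∈ (g.eval x).bind f.eval := Part.mem_bind_iff.2 ⟨a, ha, hb⟩
        exact this, t3, by omega, h⟩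
    | prec f g =>
      obtain ⟨a, m, rfl⟩ : ∃ a m, x = Nat.pair a m := ⟨_, _, (Nat.pair_unpair x).symm⟩
      rcases m with _ | m
      · rw [step_prec_zero] at h
        obtain ⟨b, hb, t3, ht3, h⟩ := ih' t le_rfl _ _ _ _ h
        exact ⟨_, by rwa [Code.eval_prec_zero], t3, by omega, h⟩
      · rw [step_prec_succ] at h
        obtain ⟨i, hi, t1, ht1, h⟩ := ih' t le_rfl _ _ _ _ h
        obtain ⟨t2, rfl, h'⟩ := pop _ _ _ _ _ _ h; replace h := h'; clear h'
        rw [step_op3] at h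
        obtain ⟨b, hb, t3, ht3, h⟩ := ih' t2 (by omega) _ _ _ _ h
        exact ⟨_, by rw [Code.eval_prec_succ]; simp; exact ⟨i, hi, hb⟩, t3, by omega, h⟩
    | rfind' f =>
      obtain ⟨a, m, rfl⟩ : ∃ a m, x = Nat.pair a m := ⟨_, _, (Nat.pair_unpair x).symm⟩
      rw [step_rfind] at h
      obtain ⟨i, hi, t1, ht1, h⟩ := ih' t le_rfl _ _ _ _ h
      obtain ⟨t2, rfl, h'⟩ := pop _ _ _ _ _ _ h; replace h := h'; clear h'
      rcases i with _ | i
      · rw [step_op4_zero] at h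
        exact ⟨m, (mem_rfind' _ _ _ _).2 ⟨0, hi, .inl ⟨rfl, rfl⟩⟩, t2, by omega, h⟩
      · rw [step_op4_succ] at h
        obtain ⟨b, hb, t3, ht3, h⟩ := ih' t2 (by omega) _ _ _ _ h
        exact ⟨b, (mem_rfind' _ _ _ _).2 ⟨_, hi, .inr ⟨by simp, hb⟩⟩, t3, by omega, h⟩

theorem eval_symU (u : ℕ) : symU.eval ![u] = u.unpair.2 := by simp [symU]
theorem eval_symT (e x u : ℕ) : symT.eval ![e, x, u] = 0 ↔
    runN u.unpair.1 (st (e+1) x 0) = st 0 (symU.eval ![u]) 0 := by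
  have h1 : (comp runSym ![fst (proj 2), state (suc (proj 0)) (proj 1) (num 0)] : PRSym 3).eval ![e,x,u]
    = runN u.unpair.1 (st (e+1) x 0) := by
    simp only [eval, runN]; congr 1; funext i; fin_cases i <;> simp
  have h2 : (comp symU ![proj 2] : PRSym 3).eval ![e,x,u] = symU.eval ![u] := by
    simp only [eval]; congr 1; funext i; fin_cases i; simp
  simp only [symT, eval_add, eval_sub, h1, eval_state, h2, eval_num]
  omega

/-- Kleene's normal form theorem: the partial function computed by a program `c` is
`x ↦ U(u)` for the `u` with `T(c, x, u)`. -/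
theorem normal_form (c : Code) (x y : ℕ) : y ∈ c.eval x ↔
    ∃ u, symT.eval ![progNum c, x, u] = 0 ∧ symU.eval ![u] = y := by
  constructor
  · intro h
    obtain ⟨t, ht⟩ := forward c x y 0 h
    exact ⟨Nat.pair t y, by rw [eval_symT]; simp [eval_symU, ht], by simp [eval_symU]⟩
  · rintro ⟨u, h, rfl⟩
    rw [eval_symT] at h
    obtain ⟨y, hy, t', _, h'⟩ := backward _ _ _ _ _ h
    rcases t' with _ | t'
    · rw [runN_zero] at h'; simp [st] at h'; rwa [← h']
    · rw [runN_succ', step_final] at h'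
      have : ∀ t, runN t (st 0 0 (pu 5 0 0 0)) = st 0 0 (pu 5 0 0 0) := by
        intro t; induction t with
        | zero => rfl
        | succ t ih => rw [runN_succ', step_dead, ih]
      rw [this] at h'; simp [st, pu] at h'

/-- There is at most one computation of a given program on a given input. -/
theorem T_unique (e x u u' : ℕ) (h : symT.eval ![e, x, u] = 0) (h' : symT.eval ![e, x, u'] = 0) : u = u' := by
  rw [eval_symT] at h h'
  have dead : ∀ t, runN t (st 0 0 (pu 5 0 0 0)) = st 0 0 (pu 5 0 0 0) := by
    intro t; induction t with
    | zero => rfl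
    | succ t ih => rw [runN_succ', step_dead, ih]
  have key : ∀ t t' s v v', t ≤ t' → runN t s = st 0 v 0 → runN t' s = st 0 v' 0 → t = t' := by
    intro t t' s v v' hle h1 h2
    obtain ⟨d, rfl⟩ := Nat.exists_eq_add_of_le hle
    rw [runN_add, h1] at h2
    rcases d with _ | d
    · rfl
    · rw [runN_succ', step_final, dead] at h2; simp [st, pu] at h2
  have e1 : u.unpair.1 = u'.unpair.1 := by
    rcases le_total u.unpair.1 u'.unpair.1 with hh | hh
    · exact key _ _ _ _ _ hh h h'
    · exact (key _ _ _ _ _ hh h' h).symm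
  rw [e1, h'] at h
  simp [st, eval_symU] at h
  rw [← Nat.pair_unpair u, ← Nat.pair_unpair u', e1, h]


end Adequacy

/-! ## Syntax -/

/-- The language of arithmetic with a function symbol for every primitive recursive definition;
equality is the only predicate. -/
def lang : FirstOrder.Language := ⟨PRSym, fun _ => Empty⟩

/-- Terms whose variables are among `x₀, …, x_{n-1}`. -/
abbrev Tm (n : ℕ) : Type := lang.Term (Fin n)

/-- The variable `xᵢ`. -/
abbrev Tm.var {n : ℕ} (i : Fin n) : Tm n := FirstOrder.Language.Term.var i

/-- Application of a function symbol. -/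
abbrev Tm.app {n m : ℕ} (f : PRSym m) (ts : Fin m → Tm n) : Tm n :=
  FirstOrder.Language.Term.func (L := lang) f ts

/-- The term `0`. -/
def Tm.zero {n : ℕ} : Tm n := Tm.app PRSym.zero Fin.elim0

/-- The term `S t`. -/
def Tm.succ {n : ℕ} (t : Tm n) : Tm n := Tm.app PRSym.succ ![t]

/-- Formulas whose free variables are among `x₀, …, x_{n-1}`. In `all φ` and `ex φ` the variable
`x₀` of `φ` is bound, and `x_{i+1}` of `φ` is `x_i` of the quantified formula. -/
inductive Fm : ℕ → Type
  | falsum {n : ℕ} : Fm n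
  | eq {n : ℕ} (s t : Tm n) : Fm n
  | and {n : ℕ} (φ ψ : Fm n) : Fm n
  | or {n : ℕ} (φ ψ : Fm n) : Fm n
  | imp {n : ℕ} (φ ψ : Fm n) : Fm n
  | all {n : ℕ} (φ : Fm (n + 1)) : Fm n
  | ex {n : ℕ} (φ : Fm (n + 1)) : Fm n

/-- Formulas without free variables. -/
abbrev Sentence : Type := Fm 0

namespace Fm

/-- Negation `¬φ` is `φ → ⊥`. -/
abbrev neg {n : ℕ} (φ : Fm n) : Fm n := imp φ falsum

def iff {n : ℕ} (φ ψ : Fm n) : Fm n := and (imp φ ψ) (imp ψ φ)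

/-- Extension of a substitution under a quantifier. -/
def liftSubst {n m : ℕ} (σ : Fin n → Tm m) : Fin (n + 1) → Tm (m + 1) :=
  Fin.cases (Tm.var 0) fun i => (σ i).relabel Fin.succ

/-- Simultaneous capture-avoiding substitution of terms for the free variables. -/
def subst : {n m : ℕ} → Fm n → (Fin n → Tm m) → Fm m
  | _, _, falsum, _ => falsum
  | _, _, eq s t, σ => eq (s.subst σ) (t.subst σ)
  | _, _, and φ ψ, σ => and (φ.subst σ) (ψ.subst σ)
  | _, _, or φ ψ, σ => or (φ.subst σ) (ψ.subst σ)
  | _, _, imp φ ψ, σ => imp (φ.subst σ) (ψ.subst σ)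
  | _, _, all φ, σ => all (φ.subst (liftSubst σ))
  | _, _, ex φ, σ => ex (φ.subst (liftSubst σ))

/-- Renaming of the free variables. -/
def rename {n m : ℕ} (φ : Fm n) (ρ : Fin n → Fin m) : Fm m := φ.subst fun i => Tm.var (ρ i)

/-- `φ`, read as a formula in which the new variable `x₀` does not occur. -/
abbrev shift {n : ℕ} (φ : Fm n) : Fm (n + 1) := φ.rename Fin.succ

/-- `φ[t/x₀]`, where the other variables move down by one. -/
def inst {n : ℕ} (φ : Fm (n + 1)) (t : Tm n) : Fm n := φ.subst (Fin.cases t Tm.var)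

/-- `φ[S x₀/x₀]`. -/
def instSucc {n : ℕ} (φ : Fm (n + 1)) : Fm (n + 1) :=
  φ.subst (Fin.cases (Tm.succ (Tm.var 0)) fun i => Tm.var i.succ)

end Fm

/-! ## Intuitionistic arithmetic -/

/-- The nonlogical axioms of Heyting arithmetic. -/
inductive HAAxiom : {n : ℕ} → Fm n → Prop
  | succ_ne_zero {n : ℕ} (t : Tm n) : HAAxiom (Fm.neg (.eq (Tm.succ t) Tm.zero))
  | succ_inj {n : ℕ} (s t : Tm n) :
      HAAxiom (.imp (.eq (Tm.succ s) (Tm.succ t)) (.eq s t))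
  | proj {n m : ℕ} (i : Fin m) (ts : Fin m → Tm n) :
      HAAxiom (.eq (Tm.app (PRSym.proj i) ts) (ts i))
  | comp {n m l : ℕ} (f : PRSym l) (g : Fin l → PRSym m) (ts : Fin m → Tm n) :
      HAAxiom (.eq (Tm.app (PRSym.comp f g) ts) (Tm.app f fun i => Tm.app (g i) ts))
  | prec_zero {n m : ℕ} (f : PRSym m) (g : PRSym (m + 2)) (ts : Fin m → Tm n) :
      HAAxiom (.eq (Tm.app (PRSym.prec f g) (Fin.cons Tm.zero ts)) (Tm.app f ts))
  | prec_succ {n m : ℕ} (f : PRSym m) (g : PRSym (m + 2)) (s : Tm n) (ts : Fin m → Tm n) :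
      HAAxiom (.eq (Tm.app (PRSym.prec f g) (Fin.cons (Tm.succ s) ts))
        (Tm.app g (Fin.cons s (Fin.cons (Tm.app (PRSym.prec f g) (Fin.cons s ts)) ts))))
  | induction {n : ℕ} (φ : Fm (n + 1)) :
      HAAxiom (.imp (.and (φ.inst Tm.zero) (.all (.imp φ φ.instSucc))) (.all φ))

/-- `Proves A Γ φ`: natural deduction for intuitionistic first-order logic with equality; the formula
`φ` is derivable from the assumptions `Γ` in the theory `HA + A`, where `A` is a set of sentences
taken as additional axioms. -/
inductive Proves (A : Set Sentence) : {n : ℕ} → List (Fm n) → Fm n → Prop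
  | ha {n : ℕ} {Γ : List (Fm n)} {φ : Fm n} : HAAxiom φ → Proves A Γ φ
  | ax {n : ℕ} {Γ : List (Fm n)} {φ : Sentence} : φ ∈ A → Proves A Γ (φ.rename Fin.elim0)
  | hyp {n : ℕ} {Γ : List (Fm n)} {φ : Fm n} : φ ∈ Γ → Proves A Γ φ
  | falsum_elim {n : ℕ} {Γ : List (Fm n)} {φ : Fm n} : Proves A Γ .falsum → Proves A Γ φ
  | and_intro {n : ℕ} {Γ : List (Fm n)} {φ ψ : Fm n} :
      Proves A Γ φ → Proves A Γ ψ → Proves A Γ (.and φ ψ)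
  | and_left {n : ℕ} {Γ : List (Fm n)} {φ ψ : Fm n} : Proves A Γ (.and φ ψ) → Proves A Γ φ
  | and_right {n : ℕ} {Γ : List (Fm n)} {φ ψ : Fm n} : Proves A Γ (.and φ ψ) → Proves A Γ ψ
  | or_inl {n : ℕ} {Γ : List (Fm n)} {φ ψ : Fm n} : Proves A Γ φ → Proves A Γ (.or φ ψ)
  | or_inr {n : ℕ} {Γ : List (Fm n)} {φ ψ : Fm n} : Proves A Γ ψ → Proves A Γ (.or φ ψ)
  | or_elim {n : ℕ} {Γ : List (Fm n)} {φ ψ χ : Fm n} :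
      Proves A Γ (.or φ ψ) → Proves A (φ :: Γ) χ → Proves A (ψ :: Γ) χ → Proves A Γ χ
  | imp_intro {n : ℕ} {Γ : List (Fm n)} {φ ψ : Fm n} :
      Proves A (φ :: Γ) ψ → Proves A Γ (.imp φ ψ)
  | imp_elim {n : ℕ} {Γ : List (Fm n)} {φ ψ : Fm n} :
      Proves A Γ (.imp φ ψ) → Proves A Γ φ → Proves A Γ ψ
  | all_intro {n : ℕ} {Γ : List (Fm n)} {φ : Fm (n + 1)} :
      Proves A (Γ.map Fm.shift) φ → Proves A Γ (.all φ)
  | all_elim {n : ℕ} {Γ : List (Fm n)} {φ : Fm (n + 1)} (t : Tm n) :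
      Proves A Γ (.all φ) → Proves A Γ (φ.inst t)
  | ex_intro {n : ℕ} {Γ : List (Fm n)} {φ : Fm (n + 1)} (t : Tm n) :
      Proves A Γ (φ.inst t) → Proves A Γ (.ex φ)
  | ex_elim {n : ℕ} {Γ : List (Fm n)} {φ : Fm (n + 1)} {ψ : Fm n} :
      Proves A Γ (.ex φ) → Proves A (φ :: Γ.map Fm.shift) ψ.shift → Proves A Γ ψ
  | eq_refl {n : ℕ} {Γ : List (Fm n)} (t : Tm n) : Proves A Γ (.eq t t)
  | eq_subst {n : ℕ} {Γ : List (Fm n)} (φ : Fm (n + 1)) {s t : Tm n} :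
      Proves A Γ (.eq s t) → Proves A Γ (φ.inst s) → Proves A Γ (φ.inst t)

/-- `HA + A ⊢ φ`. -/
def Provable (A : Set Sentence) {n : ℕ} (φ : Fm n) : Prop := Proves A [] φ

/-! ## Classes of formulas -/

/-- Quantifier-free formulas. -/
def Fm.IsQF : {n : ℕ} → Fm n → Prop
  | _, .falsum => True
  | _, .eq _ _ => True
  | _, .and φ ψ => φ.IsQF ∧ ψ.IsQF
  | _, .or φ ψ => φ.IsQF ∧ ψ.IsQF
  | _, .imp φ ψ => φ.IsQF ∧ ψ.IsQF
  | _, .all _ => False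
  | _, .ex _ => False

/-- The formulas `∃ x₁ … ∃ x_l, φ` with `l ≥ 0` and `φ` in the class `C`. -/
inductive ExPrefix (C : ∀ n : ℕ, Fm n → Prop) : ∀ n : ℕ, Fm n → Prop
  | base {n : ℕ} {φ : Fm n} : C n φ → ExPrefix C n φ
  | ex {n : ℕ} {φ : Fm (n + 1)} : ExPrefix C (n + 1) φ → ExPrefix C n (.ex φ)

/-- The formulas `∀ x₁ … ∀ x_l, φ` with `l ≥ 0` and `φ` in the class `C`. -/
inductive AllPrefix (C : ∀ n : ℕ, Fm n → Prop) : ∀ n : ℕ, Fm n → Prop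
  | base {n : ℕ} {φ : Fm n} : C n φ → AllPrefix C n φ
  | all {n : ℕ} {φ : Fm (n + 1)} : AllPrefix C (n + 1) φ → AllPrefix C n (.all φ)

mutual
/-- The class `Σ_k` (blocks of quantifiers may be empty). -/
def SigmaClass : ℕ → ∀ n : ℕ, Fm n → Prop
  | 0 => fun _ φ => φ.IsQF
  | k + 1 => ExPrefix (PiClass k)
/-- The class `Π_k` (blocks of quantifiers may be empty). -/
def PiClass : ℕ → ∀ n : ℕ, Fm n → Prop
  | 0 => fun _ φ => φ.IsQF
  | k + 1 => AllPrefix (SigmaClass k)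
end

/-- `φ ∈ Σ_k`. -/
def Fm.IsSigma (k : ℕ) {n : ℕ} (φ : Fm n) : Prop := SigmaClass k n φ

/-- The scheme `Σ_k`-DNE: the sentences `∀ x (¬¬φ(x) → φ(x))` with `φ(x) ∈ Σ_k` having no free
variable other than `x`. -/
def SigmaDNE (k : ℕ) : Set Sentence :=
  {χ | ∃ φ : Fm 1, φ.IsSigma k ∧ χ = .all (.imp φ.neg.neg φ)}

/-- The set of alternation paths of a formula; `true` is the sign `+` and `false` the sign `-`. -/
def Fm.alt : {n : ℕ} → Fm n → Finset (List Bool)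
  | _, .falsum => {[]}
  | _, .eq _ _ => {[]}
  | _, .imp φ .falsum => φ.alt.image (List.map not)
  | _, .and φ ψ => φ.alt ∪ ψ.alt
  | _, .or φ ψ => φ.alt ∪ ψ.alt
  | _, .imp φ ψ => φ.alt.image (List.map not) ∪ ψ.alt
  | _, .all φ => φ.alt.image fun s => if s.head? = some false then s else false :: s
  | _, .ex φ => φ.alt.image fun s => if s.head? = some true then s else true :: s

/-- The degree of a formula: the maximal length of its alternation paths. -/
def Fm.degree {n : ℕ} (φ : Fm n) : ℕ := φ.alt.sup List.length

/-- The class `E_k`: formulas of degree `k` all of whose alternation paths of length `k` begin with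
`+` (no condition on the paths if `k = 0`). -/
def Fm.IsE (k : ℕ) {n : ℕ} (φ : Fm n) : Prop :=
  φ.degree = k ∧ (0 < k → ∀ s ∈ φ.alt, s.length = k → s.head? = some true)

/-! ## The sentence -/

/-- The formula `T(e, x, u)`. -/
def fmT {n : ℕ} (e x u : Tm n) : Fm n := .eq (Tm.app symT ![e, x, u]) Tm.zero

/-- The term `U(u)`. -/
def tmU {n : ℕ} (u : Tm n) : Tm n := Tm.app symU ![u]

/-- `φ₀ = ¬∀x (¬∃u (T(x,x,u) ∧ U(u) = 0) ∨ ¬∃u (T(x,x,u) ∧ U(u) ≠ 0))`; under the quantifiers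
`u` is variable `0` and `x` is variable `1`. -/
def phi0 : Sentence :=
  .neg (.all (.or
    (.neg (.ex (.and (fmT (.var 1) (.var 1) (.var 0)) (.eq (tmU (.var 0)) Tm.zero))))
    (.neg (.ex (.and (fmT (.var 1) (.var 1) (.var 0)) (.neg (.eq (tmU (.var 0)) Tm.zero)))))))

end HA

/-!
The sentence `φ₀` is false in the standard model, but realizable in the sense of Kleene. A
`Σ₁`-formula, on the other hand, is true as soon as it is realizable (`Fm.IsSigma.true_of_realizes`).
Since `HA + Σ₁-DNE` is sound both for truth (`Proves.true`) and for realizability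
(`Proves.uRealized`), a `Σ₁`-formula provably equivalent to `φ₀` would be realizable, hence true,
and so `φ₀` would be true (`not_provable_iff_of_isSigma`).

`φ₀` is false since no program has two computations on the same input (`phi0_not_true`). It is
realizable since a realizer of the formula that it negates would be a program deciding a set that
separates the programs with output `0` on themselves from those with a nonzero output, and such a
set is refuted by diagonalization (`phi0_realizes`). `Σ₁`-DNE is realized by unbounded search: if
`¬¬φ` is realizable then `φ` is, classically, true, and the search for witnesses of `φ` terminates
(`sigmaDNE_realizes`).

Soundness for realizability needs realizers that are computable uniformly in the values of the free
variables and the realizers of the assumptions. Instead of coding these data as numbers, all of them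
are functions on an arbitrary `Primcodable` type of parameters, which is enlarged by a factor `ℕ`
whenever a variable or an assumption is introduced. The predicate `Computes` and its closure
properties (composition, the s-m-n theorem, recursion, search) carry all the computability that is
needed.
-/

namespace HA

open Nat.Partrec (Code)

/-! ### Uniform computation of witnesses -/

/-- Kleene application: the partial value of the program coded by `e` at `x`. -/
def app (e x : ℕ) : Part ℕ := (Denumerable.ofNat Code e).eval x

/-- `Computes P R`: some partial recursive function sends every `a` with `P a` to a number `b` with
`R a b`. -/
def Computes {α : Type} [Primcodable α] (P : α → Prop) (R : α → ℕ → Prop) : Prop :=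
  ∃ f : α →. ℕ, Partrec f ∧ ∀ a, P a → ∃ b ∈ f a, R a b

namespace Computes

variable {α β : Type} [Primcodable α] [Primcodable β] {P Q : α → Prop} {R S : α → ℕ → Prop}

theorem of_computable {g : α → ℕ} (hg : Computable g) (h : ∀ a, P a → R a (g a)) :
    Computes P R :=
  ⟨_, hg.partrec, fun a ha => ⟨g a, Part.mem_some _, h a ha⟩⟩

theorem mono (h : Computes P R) (hP : ∀ a, Q a → P a) (hR : ∀ a b, Q a → R a b → S a b) :
    Computes Q S := by
  obtain ⟨f, hf, h⟩ := h
  refine ⟨f, hf, fun a ha => ?_⟩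
  obtain ⟨b, hb, hr⟩ := h a (hP a ha)
  exact ⟨b, hb, hR a b ha hr⟩

theorem comp (h : Computes P R) {g : β → α} (hg : Computable g) :
    Computes (fun b => P (g b)) (fun b => R (g b)) := by
  obtain ⟨f, hf, h⟩ := h
  exact ⟨_, hf.comp hg, fun b hb => h (g b) hb⟩

/-- Weakening to a larger context. -/
theorem fst (h : Computes P R) {Q : α × β → Prop} (hQ : ∀ p, Q p → P p.1) :
    Computes Q (fun p => R p.1) :=
  (h.comp Computable.fst).mono hQ fun _ _ _ h => h

theorem bind (h : Computes P R)
    (h' : Computes (fun p : α × ℕ => P p.1 ∧ R p.1 p.2) (fun p => S p.1)) : Computes P S := by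
  obtain ⟨f, hf, h⟩ := h
  obtain ⟨g, hg, h'⟩ := h'
  refine ⟨fun a => (f a).bind fun b => g (a, b), hf.bind hg.to₂, fun a ha => ?_⟩
  obtain ⟨b, hb, hr⟩ := h a ha
  obtain ⟨c, hc, hs⟩ := h' (a, b) ⟨ha, hr⟩
  exact ⟨c, Part.mem_bind_iff.2 ⟨b, hb, hc⟩, hs⟩

theorem map (h : Computes P R) {g : α × ℕ → ℕ} (hg : Computable g)
    (h' : ∀ a b, P a → R a b → S a (g (a, b))) : Computes P S :=
  h.bind (of_computable hg fun p hp => h' p.1 p.2 hp.1 hp.2)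

theorem pair (h : Computes P R) (h' : Computes P S) :
    Computes P (fun a b => R a b.unpair.1 ∧ S a b.unpair.2) := by
  refine h.bind ((h'.fst (β := ℕ) fun _ hp => hp.1).map
    (g := fun p => Nat.pair p.1.2 p.2) ?_ ?_)
  · exact Primrec₂.natPair.to_comp.comp (Computable.snd.comp Computable.fst) Computable.snd
  · rintro ⟨a, b⟩ c ⟨-, hb⟩ hc
    simpa using ⟨hb, hc⟩

theorem unpair_fst (h : Computes P (fun a b => R a b.unpair.1)) : Computes P R :=
  h.map (Computable.fst.comp (Computable.unpair.comp Computable.snd)) fun _ _ _ h => h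

theorem unpair_snd (h : Computes P (fun a b => R a b.unpair.2)) : Computes P R :=
  h.map (Computable.snd.comp (Computable.unpair.comp Computable.snd)) fun _ _ _ h => h

theorem partrec_app {e x : α → ℕ} (he : Computable e) (hx : Computable x) :
    Partrec fun a => HA.app (e a) (x a) :=
  Code.eval_part.comp ((Computable.ofNat Code).comp he) hx

theorem app {e x : α → ℕ} (he : Computable e) (hx : Computable x)
    (h : ∀ a, P a → ∃ b ∈ HA.app (e a) (x a), R a b) : Computes P R :=
  ⟨_, partrec_app he hx, h⟩

/-- The s-m-n theorem: a computation from a parameter and an argument yields a program for the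
argument, computed from the parameter. -/
theorem curry {D : α → ℕ → Prop} {S : α → ℕ → ℕ → Prop}
    (h : Computes (fun p : α × ℕ => P p.1 ∧ D p.1 p.2) (fun p => S p.1 p.2)) :
    Computes P (fun a e => ∀ x, D a x → ∃ b ∈ HA.app e x, S a x b) := by
  obtain ⟨f, hf, h⟩ := h
  obtain ⟨c, hc⟩ := Code.exists_code.1 hf
  refine of_computable (g := fun a => Encodable.encode (c.curry (Encodable.encode a))) ?_ ?_
  · exact Computable.encode.comp
      ((Code.primrec₂_curry.to_comp).comp (Computable.const c) Computable.encode)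
  · intro a ha x hx
    obtain ⟨b, hb, hs⟩ := h (a, x) ⟨ha, hx⟩
    refine ⟨b, ?_, hs⟩
    have e : Encodable.decode (α := α × ℕ) (Nat.pair (Encodable.encode a) x) = some (a, x) := by
      simp
    rw [HA.app, Denumerable.ofNat_encode, Code.eval_curry, hc]
    simpa [e] using hb

/-- Case distinction along a decidable predicate. -/
theorem cond {c : α → Bool} (hc : Computable c) (h : Computes (fun a => P a ∧ c a = true) R)
    (h' : Computes (fun a => P a ∧ c a = false) R) : Computes P R := by
  obtain ⟨f, hf, h⟩ := h
  obtain ⟨g, hg, h'⟩ := h'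
  refine ⟨_, Partrec.cond hc hf hg, fun a ha => ?_⟩
  cases hca : c a
  · simpa [hca] using h' a ⟨ha, hca⟩
  · simpa [hca] using h a ⟨ha, hca⟩

/-- Primitive recursion. -/
theorem natRec {R : α → ℕ → ℕ → Prop} (h0 : Computes P (fun a => R a 0))
    (hs : Computes (fun p : α × (ℕ × ℕ) => P p.1 ∧ R p.1 p.2.1 p.2.2)
      (fun p => R p.1 (p.2.1 + 1)))
    {k : α → ℕ} (hk : Computable k) : Computes P (fun a => R a (k a)) := by
  obtain ⟨f, hf, h0⟩ := h0
  obtain ⟨g, hg, hs⟩ := hs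
  refine ⟨_, Partrec.nat_rec hk hf hg.to₂, fun a ha => ?_⟩
  show ∃ b ∈ _, R a (k a) b
  induction k a with
  | zero => exact h0 a ha
  | succ n ih =>
    obtain ⟨b, hb, hr⟩ := ih
    obtain ⟨c, hc, hr'⟩ := hs (a, (n, b)) ⟨ha, hr⟩
    exact ⟨c, Part.mem_bind_iff.2 ⟨b, hb, hc⟩, hr'⟩

/-- Unbounded search for a number satisfying a decidable predicate. -/
theorem search {c : α × ℕ → Bool} (hc : Computable c) (h : ∀ a, P a → ∃ k, c (a, k) = true) :
    Computes P (fun a k => c (a, k) = true) := by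
  refine ⟨_, Partrec.rfind (p := fun a k => Part.some (c (a, k))) hc.partrec.to₂, fun a ha => ?_⟩
  obtain ⟨k, hk⟩ := h a ha
  obtain ⟨n, hn, -⟩ := Nat.rfind_min' (p := fun k => c (a, k)) hk
  exact ⟨n, hn, by simpa using Nat.rfind_spec hn⟩

end Computes

/-! ### The standard model -/

/-- The standard model: every function symbol denotes its primitive recursive function. -/
instance natStructure : lang.Structure ℕ where
  funMap f v := PRSym.eval f v
  RelMap r _ := r.elim

@[simp] theorem realize_app {n m : ℕ} (f : PRSym m) (ts : Fin m → Tm n) (v : Fin n → ℕ) :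
    (Tm.app f ts).realize v = f.eval fun i => (ts i).realize v := rfl

@[simp] theorem realize_zero {n : ℕ} (v : Fin n → ℕ) : (Tm.zero : Tm n).realize v = 0 := rfl

@[simp] theorem realize_succ {n : ℕ} (t : Tm n) (v : Fin n → ℕ) :
    t.succ.realize v = t.realize v + 1 := rfl

/-- The valuation `v` extended by the value `x` of the variable `x₀`. -/
abbrev cons {n : ℕ} (x : ℕ) (v : Fin n → ℕ) : Fin (n + 1) → ℕ := Fin.cons x v

theorem realize_liftSubst {n m : ℕ} (σ : Fin n → Tm m) (x : ℕ) (v : Fin m → ℕ) :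
    (fun i => (Fm.liftSubst σ i).realize (cons x v)) = cons x fun i => (σ i).realize v := by
  funext i
  refine Fin.cases ?_ (fun i => ?_) i
  · simp [Fm.liftSubst]
  · simp only [Fm.liftSubst, Fin.cases_succ, FirstOrder.Language.Term.realize_relabel, Fin.cons_succ]
    rfl

theorem realize_inst {n : ℕ} (t : Tm n) (v : Fin n → ℕ) :
    (fun i => (Fin.cases t Tm.var i : Tm n).realize v) = cons (t.realize v) v := by
  funext i
  refine Fin.cases ?_ (fun i => ?_) i <;> simp

theorem realize_instSucc {n : ℕ} (x : ℕ) (v : Fin n → ℕ) :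
    (fun i => (Fin.cases (Tm.succ (Tm.var 0)) (fun i => Tm.var i.succ) i : Tm (n + 1)).realize
      (cons x v)) = cons (x + 1) v := by
  funext i
  refine Fin.cases ?_ (fun i => ?_) i <;> simp

theorem realize_shift {n : ℕ} (x : ℕ) (v : Fin n → ℕ) :
    (fun i => (Tm.var (Fin.succ i) : Tm (n + 1)).realize (cons x v)) = v := by
  funext i; simp

/-! ### Truth and realizability -/

/-- Truth of a formula in the standard model. -/
def Fm.True : {n : ℕ} → Fm n → (Fin n → ℕ) → Prop
  | _, .falsum, _ => False
  | _, .eq s t, v => s.realize v = t.realize v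
  | _, .and φ ψ, v => φ.True v ∧ ψ.True v
  | _, .or φ ψ, v => φ.True v ∨ ψ.True v
  | _, .imp φ ψ, v => φ.True v → ψ.True v
  | _, .all φ, v => ∀ x, φ.True (cons x v)
  | _, .ex φ, v => ∃ x, φ.True (cons x v)

/-- Kleene's number realizability. Realizers are taken apart with `Nat.unpair`; a true equation is
realized by every number, and a realizer of a disjunction points to the left disjunct if its first
component is `0`, and to the right one otherwise. -/
def Fm.Realizes : {n : ℕ} → Fm n → (Fin n → ℕ) → ℕ → Prop
  | _, .falsum, _, _ => False
  | _, .eq s t, v, _ => s.realize v = t.realize v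
  | _, .and φ ψ, v, e => φ.Realizes v e.unpair.1 ∧ ψ.Realizes v e.unpair.2
  | _, .or φ ψ, v, e => (e.unpair.1 = 0 ∧ φ.Realizes v e.unpair.2) ∨
      (e.unpair.1 ≠ 0 ∧ ψ.Realizes v e.unpair.2)
  | _, .imp φ ψ, v, e => ∀ a, φ.Realizes v a → ∃ b ∈ app e a, ψ.Realizes v b
  | _, .all φ, v, e => ∀ x, ∃ b ∈ app e x, φ.Realizes (cons x v) b
  | _, .ex φ, v, e => φ.Realizes (cons e.unpair.1 v) e.unpair.2

theorem true_subst {n m : ℕ} (φ : Fm n) (σ : Fin n → Tm m) (v : Fin m → ℕ) :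
    (φ.subst σ).True v ↔ φ.True fun i => (σ i).realize v := by
  induction φ generalizing m with
  | falsum => rfl
  | eq s t => simp only [Fm.subst, Fm.True, FirstOrder.Language.Term.realize_subst]
  | and φ ψ h h' => simp only [Fm.subst, Fm.True, h, h']
  | or φ ψ h h' => simp only [Fm.subst, Fm.True, h, h']
  | imp φ ψ h h' => simp only [Fm.subst, Fm.True, h, h']
  | all φ h => simp only [Fm.subst, Fm.True, h, realize_liftSubst]
  | ex φ h => simp only [Fm.subst, Fm.True, h, realize_liftSubst]

theorem realizes_subst {n m : ℕ} (φ : Fm n) (σ : Fin n → Tm m) (v : Fin m → ℕ) (e : ℕ) :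
    (φ.subst σ).Realizes v e ↔ φ.Realizes (fun i => (σ i).realize v) e := by
  induction φ generalizing m e with
  | falsum => rfl
  | eq s t => simp only [Fm.subst, Fm.Realizes, FirstOrder.Language.Term.realize_subst]
  | and φ ψ h h' => simp only [Fm.subst, Fm.Realizes, h, h']
  | or φ ψ h h' => simp only [Fm.subst, Fm.Realizes, h, h']
  | imp φ ψ h h' => simp only [Fm.subst, Fm.Realizes, h, h']
  | all φ h => simp only [Fm.subst, Fm.Realizes, h, realize_liftSubst]
  | ex φ h => simp only [Fm.subst, Fm.Realizes, h, realize_liftSubst]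

theorem true_inst {n : ℕ} (φ : Fm (n + 1)) (t : Tm n) (v : Fin n → ℕ) :
    (φ.inst t).True v ↔ φ.True (cons (t.realize v) v) := by
  rw [Fm.inst, true_subst, realize_inst]

theorem true_instSucc {n : ℕ} (φ : Fm (n + 1)) (x : ℕ) (v : Fin n → ℕ) :
    φ.instSucc.True (cons x v) ↔ φ.True (cons (x + 1) v) := by
  rw [Fm.instSucc, true_subst, realize_instSucc]

theorem true_shift {n : ℕ} (φ : Fm n) (x : ℕ) (v : Fin n → ℕ) :
    φ.shift.True (cons x v) ↔ φ.True v := by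
  rw [Fm.shift, Fm.rename, true_subst, realize_shift]

theorem realizes_inst {n : ℕ} (φ : Fm (n + 1)) (t : Tm n) (v : Fin n → ℕ) (e : ℕ) :
    (φ.inst t).Realizes v e ↔ φ.Realizes (cons (t.realize v) v) e := by
  rw [Fm.inst, realizes_subst, realize_inst]

theorem realizes_instSucc {n : ℕ} (φ : Fm (n + 1)) (x : ℕ) (v : Fin n → ℕ) (e : ℕ) :
    φ.instSucc.Realizes (cons x v) e ↔ φ.Realizes (cons (x + 1) v) e := by
  rw [Fm.instSucc, realizes_subst, realize_instSucc]

theorem realizes_shift {n : ℕ} (φ : Fm n) (x : ℕ) (v : Fin n → ℕ) (e : ℕ) :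
    φ.shift.Realizes (cons x v) e ↔ φ.Realizes v e := by
  rw [Fm.shift, Fm.rename, realizes_subst, realize_shift]

theorem realize_prec_zero {n m : ℕ} (f : PRSym m) (g : PRSym (m + 2)) (ts : Fin m → Tm n)
    (v : Fin n → ℕ) : (Tm.app (PRSym.prec f g) (Fin.cons Tm.zero ts)).realize v =
      (Tm.app f ts).realize v := rfl

theorem realize_prec_succ {n m : ℕ} (f : PRSym m) (g : PRSym (m + 2)) (s : Tm n)
    (ts : Fin m → Tm n) (v : Fin n → ℕ) :
    (Tm.app (PRSym.prec f g) (Fin.cons (Tm.succ s) ts)).realize v =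
      (Tm.app g (Fin.cons s (Fin.cons (Tm.app (PRSym.prec f g) (Fin.cons s ts)) ts))).realize v := by
  simp only [realize_app]
  show g.eval _ = g.eval _
  congr 1
  funext i
  refine Fin.cases rfl (fun i => ?_) i
  refine Fin.cases rfl (fun i => ?_) i
  rfl

/-! ### Soundness of truth -/

theorem HAAxiom.true {n : ℕ} {φ : Fm n} (h : HAAxiom φ) (v : Fin n → ℕ) : φ.True v := by
  cases h with
  | succ_ne_zero t => simp [Fm.True]
  | succ_inj s t => simp [Fm.True]
  | proj i ts => rfl
  | comp f g ts => rfl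
  | prec_zero f g ts => exact realize_prec_zero f g ts v
  | prec_succ f g s ts => exact realize_prec_succ f g s ts v
  | induction φ =>
    rintro ⟨h0, hs⟩ x
    induction x with
    | zero => simpa using (true_inst φ Tm.zero v).1 h0
    | succ x ih => exact (true_instSucc φ x v).1 (hs x ih)

/-- Soundness of the calculus for the standard model. -/
theorem Proves.true {A : Set Sentence} (hA : ∀ χ ∈ A, ∀ v, χ.True v) {n : ℕ} {Γ : List (Fm n)}
    {φ : Fm n} (h : Proves A Γ φ) (v : Fin n → ℕ) (hΓ : ∀ ψ ∈ Γ, ψ.True v) : φ.True v := by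
  induction h with
  | ha h => exact h.true v
  | ax h => exact (true_subst _ _ _).2 (hA _ h _)
  | hyp h => exact hΓ _ h
  | falsum_elim _ ih => exact (ih v hΓ).elim
  | and_intro _ _ ih ih' => exact ⟨ih v hΓ, ih' v hΓ⟩
  | and_left _ ih => exact (ih v hΓ).1
  | and_right _ ih => exact (ih v hΓ).2
  | or_inl _ ih => exact .inl (ih v hΓ)
  | or_inr _ ih => exact .inr (ih v hΓ)
  | or_elim _ _ _ ih ih1 ih2 =>
    rcases ih v hΓ with h | h
    · exact ih1 v (List.forall_mem_cons.2 ⟨h, hΓ⟩)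
    · exact ih2 v (List.forall_mem_cons.2 ⟨h, hΓ⟩)
  | imp_intro _ ih => exact fun h => ih v (List.forall_mem_cons.2 ⟨h, hΓ⟩)
  | imp_elim _ _ ih ih' => exact ih v hΓ (ih' v hΓ)
  | all_intro _ ih =>
    exact fun x => ih _ (List.forall_mem_map.2 fun ψ hψ => (true_shift ψ x v).2 (hΓ ψ hψ))
  | all_elim t _ ih => exact (true_inst _ t v).2 (ih v hΓ _)
  | ex_intro t _ ih => exact ⟨_, (true_inst _ t v).1 (ih v hΓ)⟩
  | ex_elim _ _ ih ih' =>
    obtain ⟨x, hx⟩ := ih v hΓ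
    exact (true_shift _ x v).1 (ih' _ (List.forall_mem_cons.2
      ⟨hx, List.forall_mem_map.2 fun ψ hψ => (true_shift ψ x v).2 (hΓ ψ hψ)⟩))
  | eq_refl t => rfl
  | eq_subst φ _ _ ih ih' =>
    have e := ih v hΓ
    rw [Fm.True] at e
    exact (true_inst _ _ v).2 (e ▸ (true_inst _ _ v).1 (ih' v hΓ))

/-! ### Soundness of realizability -/

variable {α : Type} [Primcodable α]

theorem computable_eval {m : ℕ} (f : PRSym m) {g : α → Fin m → ℕ}
    (hg : ∀ i, Computable fun a => g a i) : Computable fun a => f.eval (g a) := by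
  induction f generalizing α with
  | zero => exact Computable.const 0
  | succ => exact Computable.succ.comp (hg 0)
  | proj i => exact hg i
  | comp f h ihf ihh => exact ihf fun i => ihh i hg
  | prec f h ihf ihh =>
    refine Computable.nat_rec (hg 0) (ihf fun i => hg i.succ)
      (h := fun a p => h.eval (Fin.cons p.1 (Fin.cons p.2 (Fin.tail (g a))))) ?_
    refine Computable.to₂ (f := fun q : α × (ℕ × ℕ) =>
      h.eval (Fin.cons q.2.1 (Fin.cons q.2.2 (Fin.tail (g q.1))))) (ihh fun i => ?_)
    refine Fin.cases ?_ (fun i => ?_) i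
    · exact Computable.fst.comp Computable.snd
    refine Fin.cases ?_ (fun i => ?_) i
    · exact Computable.snd.comp Computable.snd
    · exact (hg i.succ).comp Computable.fst

theorem computable_realize {n : ℕ} (t : Tm n) {v : α → Fin n → ℕ}
    (hv : ∀ i, Computable fun a => v a i) : Computable fun a => t.realize (v a) := by
  induction t with
  | var i => exact hv i
  | func f ts ih => exact computable_eval f ih

theorem computable_cons {n : ℕ} {v : α → Fin n → ℕ} (hv : ∀ i, Computable fun a => v a i)
    {x : α → ℕ} (hx : Computable x) (i : Fin (n + 1)) :
    Computable fun a => cons (x a) (v a) i := by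
  refine Fin.cases ?_ (fun i => ?_) i
  · exact hx
  · exact hv i

theorem computable_comp_fst {β : Type} [Primcodable β] {n : ℕ} {v : α → Fin n → ℕ}
    (hv : ∀ i, Computable fun a => v a i) (i : Fin n) : Computable fun p : α × β => v p.1 i :=
  (hv i).comp Computable.fst

theorem computable_unpair_fst {x : α → ℕ} (hx : Computable x) : Computable fun a => (x a).unpair.1 :=
  Computable.fst.comp (Computable.unpair.comp hx)

theorem computable_unpair_snd {x : α → ℕ} (hx : Computable x) : Computable fun a => (x a).unpair.2 :=
  Computable.snd.comp (Computable.unpair.comp hx)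

/-- `φ` is realized, uniformly and effectively in the parameters `a` satisfying `P`, under the
valuation `v a`. -/
def Fm.URealized {n : ℕ} (φ : Fm n) (P : α → Prop) (v : α → Fin n → ℕ) : Prop :=
  Computes P fun a => φ.Realizes (v a)

namespace Fm.URealized

variable {n : ℕ} {φ ψ χ : Fm n} {P : α → Prop} {v : α → Fin n → ℕ}

theorem of_eq {s t : Tm n} (h : ∀ a, P a → s.realize (v a) = t.realize (v a)) :
    (Fm.eq s t).URealized P v :=
  Computes.of_computable (Computable.const 0) h

theorem or_inl (h : φ.URealized P v) : (φ.or ψ).URealized P v := by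
  refine Computes.map h (g := fun p => Nat.pair 0 p.2) ?_ ?_
  · exact Primrec₂.natPair.to_comp.comp (Computable.const 0) Computable.snd
  · intro a b _ h
    exact .inl (by simpa using h)

theorem or_inr (h : ψ.URealized P v) : (φ.or ψ).URealized P v := by
  refine Computes.map h (g := fun p => Nat.pair 1 p.2) ?_ ?_
  · exact Primrec₂.natPair.to_comp.comp (Computable.const 1) Computable.snd
  · intro a b _ h
    exact .inr (by simpa using h)

theorem imp_intro (h : ψ.URealized (fun p : α × ℕ => P p.1 ∧ φ.Realizes (v p.1) p.2)
    (fun p => v p.1)) : (φ.imp ψ).URealized P v :=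
  Computes.curry (S := fun a _ => ψ.Realizes (v a)) h

theorem all_intro {φ : Fm (n + 1)} (h : φ.URealized (fun p : α × ℕ => P p.1)
    (fun p => cons p.2 (v p.1))) : φ.all.URealized P v :=
  (Computes.curry (D := fun _ _ => _root_.True) (S := fun a x => φ.Realizes (cons x (v a)))
    (h.mono (fun _ hp => hp.1) fun _ _ _ h => h)).mono (fun _ h => h) fun _ _ _ h x => h x trivial

theorem ex_intro {φ : Fm (n + 1)} {x : α → ℕ} (hx : Computable x)
    (h : φ.URealized P (fun a => cons (x a) (v a))) : φ.ex.URealized P v := by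
  refine Computes.map h (g := fun p => Nat.pair (x p.1) p.2) ?_ ?_
  · exact Primrec₂.natPair.to_comp.comp (hx.comp Computable.fst) Computable.snd
  · intro a b _ h
    simpa [Fm.Realizes] using h

theorem imp_elim (h : (φ.imp ψ).URealized P v) (h' : φ.URealized P v) : ψ.URealized P v :=
  Computes.bind h <| (Computes.fst (β := ℕ) h' fun _ hp => hp.1).bind <|
    .app (Computable.snd.comp Computable.fst) Computable.snd fun _ hp => hp.1.2 _ hp.2

theorem or_elim (h : (φ.or ψ).URealized P v)
    (h₁ : χ.URealized (fun p : α × ℕ => P p.1 ∧ φ.Realizes (v p.1) p.2) (fun p => v p.1))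
    (h₂ : χ.URealized (fun p : α × ℕ => P p.1 ∧ ψ.Realizes (v p.1) p.2) (fun p => v p.1)) :
    χ.URealized P v := by
  have hg : Computable fun p : α × ℕ => (p.1, p.2.unpair.2) :=
    Computable.fst.pair (computable_unpair_snd Computable.snd)
  refine Computes.bind h (Computes.cond (c := fun p : α × ℕ => decide (p.2.unpair.1 = 0)) ?_ ?_ ?_)
  · exact ((Primrec.eq.decide).comp (Primrec.fst.comp (Primrec.unpair.comp Primrec.snd))
      (Primrec.const 0)).to_comp
  · refine (Computes.comp h₁ hg).mono ?_ fun _ _ _ h => h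
    rintro ⟨a, b⟩ ⟨⟨ha, h⟩, h0⟩
    exact ⟨ha, (h.resolve_right fun h => h.1 (of_decide_eq_true h0)).2⟩
  · refine (Computes.comp h₂ hg).mono ?_ fun _ _ _ h => h
    rintro ⟨a, b⟩ ⟨⟨ha, h⟩, h0⟩
    exact ⟨ha, (h.resolve_left fun h => of_decide_eq_false h0 h.1).2⟩

end Fm.URealized

theorem HAAxiom.uRealized {n : ℕ} {φ : Fm n} (h : HAAxiom φ) (P : α → Prop)
    (v : α → Fin n → ℕ) : φ.URealized P v := by
  cases h with
  | succ_ne_zero t =>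
    exact .imp_intro (.of_computable (Computable.const 0) fun p hp => by simpa [Fm.Realizes] using hp.2)
  | succ_inj s t =>
    exact .imp_intro (.of_eq fun p hp => by simpa [Fm.Realizes] using hp.2)
  | proj i ts => exact .of_eq fun a _ => rfl
  | comp f g ts => exact .of_eq fun a _ => rfl
  | prec_zero f g ts => exact .of_eq fun a _ => realize_prec_zero f g ts (v a)
  | prec_succ f g s ts => exact .of_eq fun a _ => realize_prec_succ f g s ts (v a)
  | induction φ =>
    refine .imp_intro (.all_intro (Computes.natRec (k := fun p : (α × ℕ) × ℕ => p.2)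
      (R := fun (p : (α × ℕ) × ℕ) x => φ.Realizes (cons x (v p.1.1))) ?_ ?_ Computable.snd))
    · refine .of_computable (computable_unpair_fst (Computable.snd.comp Computable.fst)) ?_
      rintro p ⟨-, h, -⟩
      simpa using (realizes_inst φ Tm.zero _ _).1 h
    -- The second premise of the axiom, applied to `x`, yields a program for `φ(x) → φ(S x)`, which
    -- is then applied to the realizer of `φ(x)`.
    · refine Computes.bind (R := fun p e => ∀ b, φ.Realizes (cons p.2.1 (v p.1.1.1)) b →
        ∃ c ∈ HA.app e b, φ.Realizes (cons (p.2.1 + 1) (v p.1.1.1)) c) ?_ ?_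
      · refine .app (e := fun p => p.1.1.2.unpair.2) (x := fun p => p.2.1) ?_ ?_ ?_
        · exact computable_unpair_snd
            (Computable.snd.comp (Computable.fst.comp Computable.fst))
        · exact Computable.fst.comp Computable.snd
        · rintro p ⟨⟨-, -, h⟩, -⟩
          obtain ⟨e, he, h⟩ := h p.2.1
          refine ⟨e, he, fun b hb => ?_⟩
          obtain ⟨c, hc, h⟩ := h b hb
          exact ⟨c, hc, (realizes_instSucc φ _ _ _).1 h⟩
      · exact .app Computable.snd (Computable.snd.comp (Computable.snd.comp Computable.fst))
          fun p hp => hp.2 _ hp.1.2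

/-- Soundness of the calculus for realizability. The parameter type `α` grows along the derivation:
each assumption or variable that is introduced becomes a new numerical parameter. -/
theorem Proves.uRealized {A : Set Sentence} (hA : ∀ χ ∈ A, ∃ e, ∀ v, χ.Realizes v e) {n : ℕ}
    {Γ : List (Fm n)} {φ : Fm n} (h : Proves A Γ φ) (P : α → Prop) {v : α → Fin n → ℕ}
    (hv : ∀ i, Computable fun a => v a i) (hΓ : ∀ ψ ∈ Γ, ψ.URealized P v) : φ.URealized P v := by
  have weak : ∀ {α : Type} [Primcodable α] {n : ℕ} {Γ : List (Fm n)} {P : α → Prop}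
      {v : α → Fin n → ℕ} (φ : Fm n), (∀ ψ ∈ Γ, ψ.URealized P v) → ∀ ψ ∈ φ :: Γ, ψ.URealized
        (fun p : α × ℕ => P p.1 ∧ φ.Realizes (v p.1) p.2) (fun p => v p.1) :=
    fun _ hΓ => List.forall_mem_cons.2 ⟨.of_computable Computable.snd fun _ hp => hp.2,
      fun ψ hψ => Computes.fst (hΓ ψ hψ) fun _ hp => hp.1⟩
  have shift : ∀ {α : Type} [Primcodable α] {n : ℕ} {Γ : List (Fm n)} {P : α → Prop}
      {v : α → Fin n → ℕ} (Q : α × ℕ → Prop) (x : α × ℕ → ℕ), (∀ p, Q p → P p.1) →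
      (∀ ψ ∈ Γ, ψ.URealized P v) →
      ∀ ψ ∈ Γ.map Fm.shift, ψ.URealized Q (fun p => cons (x p) (v p.1)) :=
    fun Q x hQ hΓ => List.forall_mem_map.2 fun ψ hψ => (Computes.fst (hΓ ψ hψ) hQ).mono
      (fun _ h => h) fun _ _ _ h => (realizes_shift ψ _ _ _).2 h
  induction h generalizing α with
  | ha h => exact h.uRealized P _
  | ax h =>
    obtain ⟨e, he⟩ := hA _ h
    exact .of_computable (Computable.const e) fun a _ => (realizes_subst _ _ _ _).2 (he _)
  | hyp h => exact hΓ _ h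
  | falsum_elim _ ih => exact (ih P hv hΓ).mono (fun _ h => h) fun _ _ _ h => h.elim
  | and_intro _ _ ih ih' => exact (ih P hv hΓ).pair (ih' P hv hΓ)
  | and_left _ ih => exact ((ih P hv hΓ).mono (fun _ h => h) fun _ _ _ h => h.1).unpair_fst
  | and_right _ ih => exact ((ih P hv hΓ).mono (fun _ h => h) fun _ _ _ h => h.2).unpair_snd
  | or_inl _ ih => exact (ih P hv hΓ).or_inl
  | or_inr _ ih => exact (ih P hv hΓ).or_inr
  | or_elim _ _ _ ih ih₁ ih₂ =>
    exact (ih P hv hΓ).or_elim (ih₁ _ (computable_comp_fst hv) (weak _ hΓ))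
      (ih₂ _ (computable_comp_fst hv) (weak _ hΓ))
  | imp_intro _ ih => exact .imp_intro (ih _ (computable_comp_fst hv) (weak _ hΓ))
  | imp_elim _ _ ih ih' => exact (ih P hv hΓ).imp_elim (ih' P hv hΓ)
  | all_intro _ ih =>
    exact .all_intro (ih _ (computable_cons (computable_comp_fst hv) Computable.snd)
      (shift _ _ (fun _ h => h) hΓ))
  | all_elim t _ ih =>
    refine (ih P hv hΓ).bind (.app Computable.snd
      ((computable_realize t hv).comp Computable.fst) ?_)
    rintro p ⟨-, h⟩
    obtain ⟨b, hb, h⟩ := h (t.realize (v p.1))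
    exact ⟨b, hb, (realizes_inst _ t _ _).2 h⟩
  | ex_intro t _ ih =>
    exact .ex_intro (computable_realize t hv) ((ih P hv hΓ).mono (fun _ h => h)
      fun _ _ _ h => (realizes_inst _ t _ _).1 h)
  | ex_elim _ _ ih ih' =>
    refine (ih P hv hΓ).bind ?_
    have hx : Computable fun p : α × ℕ => p.2.unpair.1 := computable_unpair_fst Computable.snd
    refine (ih' _ (computable_cons (computable_comp_fst hv) hx) (List.forall_mem_cons.2
      ⟨?_, shift _ _ (fun p hp => hp.1) hΓ⟩)).mono (fun _ h => h)
        fun _ _ _ h => (realizes_shift _ _ _ _).1 h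
    exact .of_computable (computable_unpair_snd Computable.snd) fun _ hp => hp.2
  | eq_refl t => exact .of_eq fun _ _ => rfl
  | eq_subst φ _ _ ih ih' =>
    refine (ih P hv hΓ).bind ((Computes.fst (ih' P hv hΓ) fun _ hp => hp.1).mono
      (fun _ h => h) ?_)
    rintro p b ⟨-, e⟩ h
    rw [Fm.Realizes] at e
    exact (realizes_inst _ _ _ _).2 (e ▸ (realizes_inst _ _ _ _).1 h)

/-! ### Realizability of `Σ₁`-formulas -/

theorem Fm.IsQF.decidable {n : ℕ} {φ : Fm n} (h : φ.IsQF) {v : α → Fin n → ℕ}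
    (hv : ∀ i, Computable fun a => v a i) :
    ∃ c : α → Bool, Computable c ∧ ∀ a, c a = true ↔ φ.True (v a) := by
  induction φ with
  | falsum => exact ⟨_, Computable.const false, fun a => by simp [Fm.True]⟩
  | eq s t =>
    exact ⟨_, Primrec.eq.decide.to_comp.comp (computable_realize s hv) (computable_realize t hv),
      fun a => by simp [Fm.True]⟩
  | and φ ψ ih ih' =>
    obtain ⟨c, hc, hc'⟩ := ih h.1 hv
    obtain ⟨d, hd, hd'⟩ := ih' h.2 hv
    exact ⟨_, Primrec.and.to_comp.comp hc hd, fun a => by simp [Fm.True, ← hc', ← hd']⟩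
  | or φ ψ ih ih' =>
    obtain ⟨c, hc, hc'⟩ := ih h.1 hv
    obtain ⟨d, hd, hd'⟩ := ih' h.2 hv
    exact ⟨_, Primrec.or.to_comp.comp hc hd, fun a => by simp [Fm.True, ← hc', ← hd']⟩
  | imp φ ψ ih ih' =>
    obtain ⟨c, hc, hc'⟩ := ih h.1 hv
    obtain ⟨d, hd, hd'⟩ := ih' h.2 hv
    refine ⟨_, Primrec.or.to_comp.comp (Primrec.not.to_comp.comp hc) hd, fun a => ?_⟩
    simp only [Fm.True, ← hc', ← hd']
    cases c a <;> simp
  | all φ => exact h.elim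
  | ex φ => exact h.elim

/-- For quantifier-free formulas, realizability is truth, and realizers can be computed. -/
theorem Fm.IsQF.true_and_uRealized {n : ℕ} {φ : Fm n} (h : φ.IsQF) :
    (∀ v e, φ.Realizes v e → φ.True v) ∧
    ∀ {α : Type} [Primcodable α] {v : α → Fin n → ℕ}, (∀ i, Computable fun a => v a i) →
      φ.URealized (fun a => φ.True (v a)) v := by
  induction φ with
  | falsum => exact ⟨fun _ _ h => h, fun _ => .of_computable (Computable.const 0) fun _ h => h⟩
  | eq s t => exact ⟨fun _ _ h => h, fun _ => .of_eq fun _ h => h⟩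
  | and φ ψ ih ih' =>
    refine ⟨fun v e he => ⟨(ih h.1).1 v _ he.1, (ih' h.2).1 v _ he.2⟩, fun hv => ?_⟩
    exact (((ih h.1).2 hv).mono (fun _ h => h.1) fun _ _ _ h => h).pair
      (((ih' h.2).2 hv).mono (fun _ h => h.2) fun _ _ _ h => h)
  | or φ ψ ih ih' =>
    refine ⟨fun v e he => he.imp (fun h' => (ih h.1).1 v _ h'.2) fun h' => (ih' h.2).1 v _ h'.2,
      fun hv => ?_⟩
    obtain ⟨c, hc, hc'⟩ := h.1.decidable hv
    refine Computes.cond hc (URealized.or_inl ?_) (URealized.or_inr ?_)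
    · exact ((ih h.1).2 hv).mono (fun a h => (hc' a).1 h.2) fun _ _ _ h => h
    · exact ((ih' h.2).2 hv).mono (fun a h => h.1.resolve_left fun h' => by
        simp [(hc' a).2 h'] at h) fun _ _ _ h => h
  | imp φ ψ ih ih' =>
    constructor
    · intro v e he hφ
      obtain ⟨f, -, hf⟩ := (ih h.1).2 (α := Unit) (v := fun _ => v) fun _ => Computable.const _
      obtain ⟨b, -, hb⟩ := hf () hφ
      obtain ⟨c, -, hc⟩ := he b hb
      exact (ih' h.2).1 v c hc
    · intro α _ v hv
      exact .imp_intro (((ih' h.2).2 (computable_comp_fst hv)).mono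
        (fun p hp => hp.1 ((ih h.1).1 _ _ hp.2)) fun _ _ _ h => h)
  | all φ => exact h.elim
  | ex φ => exact h.elim

theorem Fm.IsSigma.true_of_realizes {n : ℕ} {φ : Fm n} (h : φ.IsSigma 1) {v : Fin n → ℕ} {e : ℕ}
    (he : φ.Realizes v e) : φ.True v := by
  rw [Fm.IsSigma, SigmaClass] at h
  induction h generalizing e with
  | base h => exact (Fm.IsQF.true_and_uRealized (by rwa [PiClass] at h)).1 _ _ he
  | ex _ ih => exact ⟨_, ih he⟩

/-- The truth of a `Σ₁`-formula is semidecidable. -/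
theorem Fm.IsSigma.semidecidable {n : ℕ} {φ : Fm n} (h : φ.IsSigma 1) {v : α → Fin n → ℕ}
    (hv : ∀ i, Computable fun a => v a i) :
    ∃ c : α × ℕ → Bool, Computable c ∧ ∀ a, (∃ k, c (a, k) = true) ↔ φ.True (v a) := by
  rw [Fm.IsSigma, SigmaClass] at h
  induction h generalizing α with
  | base h =>
    obtain ⟨c, hc, hc'⟩ := Fm.IsQF.decidable (by rwa [PiClass] at h) hv
    exact ⟨_, hc.comp Computable.fst, fun a => by simp [hc']⟩
  | ex _ ih =>
    obtain ⟨c, hc, hc'⟩ := ih (computable_cons (computable_comp_fst hv) Computable.snd)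
    refine ⟨fun p => c ((p.1, p.2.unpair.1), p.2.unpair.2), hc.comp
      ((Computable.fst.pair (computable_unpair_fst Computable.snd)).pair
        (computable_unpair_snd Computable.snd)), fun a => ?_⟩
    simp only [Fm.True, ← hc' (a, _)]
    constructor
    · rintro ⟨k, hk⟩
      exact ⟨_, _, hk⟩
    · rintro ⟨x, k, hk⟩
      exact ⟨Nat.pair x k, by simpa using hk⟩

/-- Realizers of true `Σ₁`-formulas are found by unbounded search for witnesses. -/
theorem Fm.IsSigma.uRealized {n : ℕ} {φ : Fm n} (h : φ.IsSigma 1) {v : α → Fin n → ℕ}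
    (hv : ∀ i, Computable fun a => v a i) : φ.URealized (fun a => φ.True (v a)) v := by
  rw [Fm.IsSigma, SigmaClass] at h
  induction h generalizing α with
  | base h => exact (Fm.IsQF.true_and_uRealized (by rwa [PiClass] at h)).2 hv
  | ex h ih =>
    obtain ⟨c, hc, hc'⟩ := Fm.IsSigma.semidecidable (by rwa [Fm.IsSigma, SigmaClass])
      (computable_cons (computable_comp_fst (β := ℕ) hv) Computable.snd)
    have hx : Computable fun p : α × ℕ => p.2.unpair.1 := computable_unpair_fst Computable.snd
    refine (Computes.search (c := fun p => c ((p.1, p.2.unpair.1), p.2.unpair.2)) ?_ ?_).bind ?_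
    · exact hc.comp ((Computable.fst.pair hx).pair (computable_unpair_snd Computable.snd))
    · rintro a ⟨x, hx⟩
      obtain ⟨k, hk⟩ := (hc' (a, x)).2 hx
      exact ⟨Nat.pair x k, by simpa using hk⟩
    · refine Fm.URealized.ex_intro hx ((ih (computable_cons (computable_comp_fst hv) hx)).mono
        ?_ fun _ _ _ h => h)
      rintro p ⟨-, hp⟩
      exact (hc' (p.1, p.2.unpair.1)).1 ⟨_, hp⟩

theorem sigmaDNE_true {χ : Sentence} (h : χ ∈ SigmaDNE 1) (v : Fin 0 → ℕ) : χ.True v := by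
  obtain ⟨φ, -, rfl⟩ := h
  exact fun x h => not_not.1 h

/-- `Σ₁`-DNE is realizable: a realizable double negation is true, so the search for witnesses
terminates. -/
theorem sigmaDNE_realizes {χ : Sentence} (h : χ ∈ SigmaDNE 1) : ∃ e, ∀ v, χ.Realizes v e := by
  obtain ⟨φ, hφ, rfl⟩ := h
  have : (Fm.all (.imp φ.neg.neg φ)).URealized (fun _ : Unit => True) fun _ => Fin.elim0 := by
    refine .all_intro (.imp_intro ((hφ.uRealized (α := (Unit × ℕ) × ℕ) ?_).mono ?_ fun _ _ _ h => h))
    · exact computable_comp_fst (α := Unit × ℕ) (β := ℕ)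
        (computable_cons (v := fun _ => Fin.elim0) (fun i => i.elim0) Computable.snd)
    · rintro p ⟨-, h⟩
      by_contra hn
      obtain ⟨b, -, hb⟩ := h 0 fun a ha => (hn (hφ.true_of_realizes ha)).elim
      exact hb
  obtain ⟨f, -, hf⟩ := this
  obtain ⟨e, -, he⟩ := hf () trivial
  exact ⟨e, fun v => Subsingleton.elim Fin.elim0 v ▸ he⟩

/-! ### The sentence `φ₀` -/

theorem phi0_isE : phi0.IsE 1 := by
  have h : phi0.alt = {[true]} := by decide
  simp [Fm.IsE, Fm.degree, h]

theorem realize_symT {n : ℕ} (e x u : Tm n) (v : Fin n → ℕ) :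
    (Tm.app symT ![e, x, u]).realize v =
      symT.eval ![e.realize v, x.realize v, u.realize v] := by
  rw [realize_app]
  congr 1
  funext i
  fin_cases i <;> rfl

theorem realize_tmU {n : ℕ} (u : Tm n) (v : Fin n → ℕ) :
    (tmU u).realize v = symU.eval ![u.realize v] := by
  rw [tmU, realize_app]
  congr 1
  funext i
  fin_cases i
  rfl

/-- Computations being unique, a program cannot have both output `0` and another output. -/
theorem phi0_not_true (v : Fin 0 → ℕ) : ¬ phi0.True v := by
  intro h
  refine h fun x => or_iff_not_imp_left.2 fun h₁ => ?_
  obtain ⟨u, hu, hu0⟩ := not_not.1 h₁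
  rintro ⟨u', hu', hu0'⟩
  simp only [fmT, Fm.True, realize_symT, realize_tmU, realize_zero] at hu hu0 hu' hu0'
  exact hu0' (T_unique _ _ _ _ hu hu' ▸ hu0)

/-- A realizer of the formula negated in `φ₀` would decide a set separating the programs that output
`0` on themselves from those with another output on themselves; the diagonal program refutes
this. Hence every number realizes `φ₀`. -/
theorem phi0_realizes (v : Fin 0 → ℕ) (e : ℕ) : phi0.Realizes v e := by
  intro d hd
  exfalso
  have hf : Partrec fun x => (app d x).map fun b => if b.unpair.1 = 0 then 0 else 1 := by
    refine (Computes.partrec_app (Computable.const d) Computable.id).map ?_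
    exact (Primrec.ite (Primrec.eq.comp (Primrec.fst.comp (Primrec.unpair.comp Primrec.snd))
      (Primrec.const 0)) (Primrec.const 0) (Primrec.const 1)).to_comp.to₂
  obtain ⟨c, hc⟩ := Code.exists_code.1 (Partrec.nat_iff.1 hf)
  obtain ⟨b, hb, h⟩ := hd (progNum c)
  have hcb : (if b.unpair.1 = 0 then 0 else 1) ∈ c.eval (progNum c) := by
    rw [hc]
    exact Part.mem_map _ hb
  obtain ⟨u, hu, hu'⟩ := (normal_form _ _ _).1 hcb
  -- As the body is quantifier-free, any number whose first projection is `u` realizes `∃u …`.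
  rcases h with ⟨h0, h⟩ | ⟨h0, h⟩
  · rw [if_pos h0] at hu'
    obtain ⟨z, -, hz⟩ := h (Nat.pair u 0) (by
      simp only [fmT, Fm.Realizes, realize_symT, realize_tmU, realize_zero, Nat.unpair_pair]
      exact ⟨hu, hu'⟩)
    exact hz
  · rw [if_neg h0] at hu'
    obtain ⟨z, -, hz⟩ := h (Nat.pair u 0) (by
      simp only [fmT, Fm.Realizes, realize_symT, realize_tmU, realize_zero, Nat.unpair_pair]
      refine ⟨hu, fun _ h => ?_⟩
      exact absurd (hu'.symm.trans h) one_ne_zero)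
    exact hz

/-- A false formula that is realized by every number is not equivalent to a `Σ₁`-formula: the latter
would be realizable, hence true. -/
theorem not_provable_iff_of_isSigma {n : ℕ} {φ ψ : Fm n} (hr : ∀ v e, φ.Realizes v e)
    (ht : ∀ v, ¬ φ.True v) (hψ : ψ.IsSigma 1) : ¬ Provable (SigmaDNE 1) (φ.iff ψ) := by
  intro h
  let v : Fin n → ℕ := fun _ => 0
  have hψv : ψ.True v := by
    obtain ⟨f, -, hf⟩ := Proves.uRealized (fun χ => sigmaDNE_realizes) h (α := Unit)
      (fun _ => True) (v := fun _ => v) (fun _ => Computable.const _) (by simp)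
    obtain ⟨b, -, hb, -⟩ := hf () trivial
    obtain ⟨c, -, hc⟩ := hb 0 (hr _ _)
    exact hψ.true_of_realizes hc
  exact ht v ((Proves.true (fun χ => sigmaDNE_true) h v (by simp)).2 hψv)

end HA

theorem mainTheorem2 :
    HA.phi0.IsE 1 ∧
    (∀ ψ : HA.Sentence, ψ.IsSigma 1 → ¬ HA.Provable (HA.SigmaDNE 1) (HA.phi0.iff ψ)) ∧
    ¬ (∀ (n : ℕ) (φ : HA.Fm n), φ.IsE 1 →
        ∃ (m : ℕ) (φ' : HA.Fm (n + m)), φ'.IsSigma 1 ∧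
          HA.Provable (HA.SigmaDNE 1) ((φ.rename (Fin.castAdd m)).iff φ')) := by
  refine ⟨HA.phi0_isE, fun ψ hψ =>
    HA.not_provable_iff_of_isSigma HA.phi0_realizes HA.phi0_not_true hψ, fun h => ?_⟩
  obtain ⟨m, φ', hφ', h⟩ := h 0 HA.phi0 HA.phi0_isE
  refine HA.not_provable_iff_of_isSigma (fun v e => ?_) (fun v hv => ?_) hφ' h
  · exact (HA.realizes_subst _ _ _ _).2 (HA.phi0_realizes _ _)
  · exact HA.phi0_not_true _ ((HA.true_subst _ _ _).1 hv)
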